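/- Let $\varphi:\mathbb R^n\to\mathbb R$ be differentiable with $L_1$-Lipschitz gradient ($L_1>0$), let $g:\mathbb R^n\to\mathbb R\cup\{+\infty\}$ be proper, lower semicontinuous and convex, let $h:\mathbb R^n\to\mathbb R$ be convex and differentiable with $L_3$-Lipschitz gradient, and put $f=\varphi+g-h$. Let $\alpha,\beta,\gamma,\tau,\lambda,\mu$ be real numbers with $\lambda,\mu,\beta>0$, $\alpha+\beta>0$, $\tau>-\frac{2+\alpha}{2\beta}$, $\gamma\ge\frac12$, and put $$\rho=1+\tau\beta+\tfrac{\alpha+\beta}{2},\quad a=\tfrac{2\alpha}{2+\alpha+\beta},\quad b=\tfrac{2\beta}{2+\alpha+\beta},\quad a_2=a\Big[1+2b\Big(\tfrac{\gamma+\tau}{2}-\tfrac12\Big)\Big],\quad b_2=b\Big[1+b\Big(\tau-\tfrac12\Big)\Big],\quad \delta_1=(a_2+b_2)\frac{\lambda}{\rho\mu}.$$ Assume $\lambda L_1+\mu(\gamma\alpha+\rho)\le 1$ and $a_2+b_2>0$ (that is, $\delta_1>0$). Given arbitrary $x^0,y^0\in\mathbb R^n$, let $(x^k,y^k)$ be generated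 by the Maingé–Moudafi inertial proximal method: for $k=0,1,2,\dots$, $x^{k+1}$ is the minimizer over $x\in\mathbb R^n$ of $$g(x)-\langle\nabla h(x^k)-\nabla\varphi(x^k),x-x^k\rangle+\frac{\mu}{\lambda}\langle\alpha x^k+\beta y^k,x-x^k\rangle+\frac1{2\lambda}\|x-x^k\|^2,$$ and $y^{k+1}=y^k-\frac1\rho\big[\alpha x^k+\beta y^k+\gamma\alpha(x^{k+1}-x^k)\big]$. Write $z^k=(x^k,y^k)$ and $\phi(x,y)=\delta_1f(x)+\frac12\|ax+by\|^2$. A function $F:\mathbb R^m\to\mathbb R\cup\{+\infty\}$, with limiting (Mordukhovich) subdifferential $\partial F$, satisfies the Kurdyka–Łojasiewicz inequality at $\bar z$ with $\theta$ if there are $\epsilon>0$ and a neighbourhood $U$ of $\bar z$ such that $\theta:[0,\epsilon)\to[0,\infty)$ is continuous and concave, $\theta(0)=0$, $\theta>0$ on $(0,\epsilon)$, $\theta$ is $C^1$ on $(0,\epsilon)$, and $\theta'(F(z)-F(\bar z))\,d(0;\partial F(z))\ge1$ for all $z\in U$ with $F(\bar z)<F(z)<F(\bar z)+\epsilon$.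 It is a Kurdyka–Łojasiewicz function if, at every point where $\partial F\neq\emptyset$, this holds with some $\theta$. Assume that $\phi$ is a Kurdyka–Łojasiewicz function. Then: (a) for all $k\ge 0$, $$\phi(z^{k+1})\le\phi(z^k)-\tfrac12(2a_2+b_2)\|x^{k+1}-x^k\|^2-\tfrac{b_2}2\|y^{k+1}-y^k\|^2-\tfrac{b_2}2\|(x^{k+1}-x^k)-(y^{k+1}-y^k)\|^2 .$$ Assume moreover $4a_2+3b_2\ge0$, which means that $\delta_1$ lies in $\big[\frac{\lambda}{\rho\mu}(\sqrt{b_2}-\sqrt{a_2+b_2})^2,\frac{\lambda}{\rho\mu}(\sqrt{b_2}+\sqrt{a_2+b_2})^2\big]$. (This condition and $a_2+b_2>0$ both hold automatically when $\alpha\ge0$.) (b) If $x^*$ is a limit point of $(x^k)$, then the whole sequence $(x^k)$ converges to $x^*$. (c) If, in addition, $\phi$ satisfies the Kurdyka–Łojasiewicz inequality at $z^*=(x^*,-\frac\alpha\beta x^*)$ with $\theta(t)=Mt^{1-\kappa}$, where $M>0$ and $\kappa\in[0,1)$, then: (i) if $\kappa=0$, the method terminates finitely: $z^k=z^*$ for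 all sufficiently large $k$; (ii) if $0<\kappa\le\frac12$, there are $A_1>0$ and $\zeta\in(0,1)$ with $\|x^k-x^*\|\le A_1\zeta^k$ for all $k\ge 0$; (iii) if $\frac12<\kappa<1$, there is $A_2>0$ with $\|x^k-x^*\|\le A_2k^{\frac{1-\kappa}{1-2\kappa}}$ for all $k\ge1$. -/

import Mathlib

open Set Filter Topology

/-- `ℝⁿ` with its Euclidean structure. -/
abbrev RVec (n : ℕ) : Type := EuclideanSpace ℝ (Fin n)

/-- `ℝⁿ × ℝⁿ` with its Euclidean structure, `‖(x, y)‖² = ‖x‖² + ‖y‖²`. -/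
abbrev RPair (n : ℕ) : Type := WithLp 2 (RVec n × RVec n)

section Subdifferential

variable {E : Type*} [NormedAddCommGroup E] [InnerProductSpace ℝ E]

/-- An extended-real-valued function with values in `ℝ ∪ {+∞}` that is not identically `+∞`. -/
def IsProperFun (g : E → EReal) : Prop :=
  (∀ x, g x ≠ ⊥) ∧ ∃ x, g x < ⊤

/-- Convexity of a function with values in `ℝ ∪ {+∞}`. -/
def IsConvexFun (g : E → EReal) : Prop :=
  ∀ x y : E, ∀ t : ℝ, 0 < t → t < 1 →
    g (t • x + (1 - t) • y) ≤ (t : EReal) * g x + ((1 - t : ℝ) : EReal) * g y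

/-- The Fréchet subdifferential of `F : E → ℝ ∪ {+∞}` at `x`; it is empty when `x ∉ dom F`.
For `x ∈ dom F` the condition says that the lower limit, as `w → x` with `w ≠ x`, of
`(F w - F x - ⟪v, w - x⟫) / ‖w - x‖` is nonnegative. -/
def frechetSubdiff (F : E → EReal) (x : E) : Set E :=
  {v | F x < ⊤ ∧ ∀ ε : ℝ, 0 < ε → ∀ᶠ w in 𝓝 x,
    F x + ((inner ℝ v (w - x) - ε * ‖w - x‖ : ℝ) : EReal) ≤ F w}

/-- The limiting (Mordukhovich) subdifferential: limits of Fréchet subgradients along sequences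
`xₖ → x` with `F xₖ → F x`; it is empty when `x ∉ dom F`. -/
def limitingSubdiff (F : E → EReal) (x : E) : Set E :=
  {v | F x < ⊤ ∧ ∃ (xs vs : ℕ → E), Tendsto xs atTop (𝓝 x) ∧
    Tendsto (fun k => F (xs k)) atTop (𝓝 (F x)) ∧
    (∀ k, vs k ∈ frechetSubdiff F (xs k)) ∧ Tendsto vs atTop (𝓝 v)}

/-- The Kurdyka–Łojasiewicz inequality for `F` at `xbar` holds with the function `θ`: for some
`ε > 0` and some neighbourhood `U` of `xbar`, the function `θ : [0, ε) → [0, ∞)` is continuous and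
concave, vanishes at `0`, is positive and `C¹` on `(0, ε)`, and
`θ'(F x - F xbar) * dist (0, ∂F x) ≥ 1` for `x ∈ U` with `F xbar < F x < F xbar + ε`.
(The distance to the empty set is `+∞`.) -/
def KLInequalityAt (F : E → EReal) (xbar : E) (θ : ℝ → ℝ) : Prop :=
  ∃ ε : ℝ, 0 < ε ∧ ∃ U ∈ 𝓝 xbar,
    ContinuousOn θ (Ico 0 ε) ∧ ConcaveOn ℝ (Ico 0 ε) θ ∧
    (∀ t ∈ Ico 0 ε, 0 ≤ θ t) ∧ θ 0 = 0 ∧ (∀ t ∈ Ioo 0 ε, 0 < θ t) ∧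
    ContDiffOn ℝ 1 θ (Ioo 0 ε) ∧
    ∀ x ∈ U, F xbar < F x → F x < F xbar + (ε : EReal) →
      1 ≤ ENNReal.ofReal (deriv θ (F x - F xbar).toReal) *
        Metric.infEDist 0 (limitingSubdiff F x)

/-- A Kurdyka–Łojasiewicz function: at every point of `dom ∂F` the Kurdyka–Łojasiewicz inequality
holds with some `θ`. -/
def IsKLFunction (F : E → EReal) : Prop :=
  ∀ x, (limitingSubdiff F x).Nonempty → ∃ θ : ℝ → ℝ, KLInequalityAt F x θ

end Subdifferential

/-- The real parameters of the inertial proximal method (`lam`, `mu` stand for `λ`, `μ`). -/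
structure InertialParams where
  α : ℝ
  β : ℝ
  γ : ℝ
  τ : ℝ
  lam : ℝ
  mu : ℝ

namespace InertialParams

noncomputable section

variable (p : InertialParams)

def ρ : ℝ := 1 + p.τ * p.β + (p.α + p.β) / 2

def a : ℝ := 2 * p.α / (2 + p.α + p.β)

def b : ℝ := 2 * p.β / (2 + p.α + p.β)

def a₂ : ℝ := p.a * (1 + 2 * p.b * ((p.γ + p.τ) / 2 - 1 / 2))

def b₂ : ℝ := p.b * (1 + p.b * (p.τ - 1 / 2))

def δ₁ : ℝ := (p.a₂ + p.b₂) * (p.lam / (p.ρ * p.mu))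

end

end InertialParams

noncomputable section

variable {n : ℕ}

/-- The objective `f = φ + g - h`. -/
def dcObjective (φ : RVec n → ℝ) (g : RVec n → EReal) (h : RVec n → ℝ) (x : RVec n) : EReal :=
  (φ x : EReal) + g x - (h x : EReal)

/-- The function minimized over `w` to obtain the next iterate from `(x, y)`. -/
def proxObjective (p : InertialParams) (φ : RVec n → ℝ) (g : RVec n → EReal) (h : RVec n → ℝ)
    (x y w : RVec n) : EReal :=
  g w + ((- inner ℝ (gradient h x - gradient φ x) (w - x)
    + p.mu / p.lam * inner ℝ (p.α • x + p.β • y) (w - x)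
    + 1 / (2 * p.lam) * ‖w - x‖ ^ 2 : ℝ) : EReal)

/-- `(x k, y k)` is generated by the inertial proximal method: `x (k + 1)` minimizes the
proximal objective over `ℝⁿ`, then `y` is updated. The starting point is arbitrary. -/
structure IsInertialProxSeq (p : InertialParams) (φ : RVec n → ℝ) (g : RVec n → EReal)
    (h : RVec n → ℝ) (x y : ℕ → RVec n) : Prop where
  prox_step : ∀ k, ∀ w : RVec n,
    proxObjective p φ g h (x k) (y k) (x (k + 1)) ≤ proxObjective p φ g h (x k) (y k) w
  inertial_step : ∀ k, y (k + 1) = y k -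
    (1 / p.ρ) • (p.α • x k + p.β • y k + (p.γ * p.α) • (x (k + 1) - x k))

/-- The energy `(x, y) ↦ δ₁ f(x) + ½ ‖a x + b y‖²`. -/
def energy (p : InertialParams) (φ : RVec n → ℝ) (g : RVec n → EReal) (h : RVec n → ℝ)
    (z : RPair n) : EReal :=
  (p.δ₁ : EReal) * dcObjective φ g h z.fst
    + ((1 / 2 * ‖p.a • z.fst + p.b • z.snd‖ ^ 2 : ℝ) : EReal)

end

/-!
The inertial proximal method is a descent method for the energy
`Φ (x, y) = δ₁ f x + ½ ‖a x + b y‖²`, and the Kurdyka–Łojasiewicz inequality turns descent into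
convergence with rates.

*Decrease.* The optimality condition of the proximal step exhibits a convex subgradient of `g` at
`x (k + 1)` (`subgradient_of_prox_minimizer`). Together with the quadratic expansion of `φ` and the
convexity of `h` it bounds `f (x (k + 1)) - f (x k)`. The quadratic part of `Φ` changes by an
explicit quadratic form in the increments (`InertialParams.half_norm_sq_step`), and the weights
`a₂`, `b₂`, `δ₁` are such that the two contributions add up to the asserted decrease. The expansion
of `φ` costs `L₁ / 2` while the step size condition provides for `L₁`, so a positive multiple of
`‖x (k + 1) - x k‖²` is left over. It makes the decrease coercive even when `4 a₂ + 3 b₂ = 0`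
(`InertialParams.exists_coercive`).

*Subgradients.* Since the nonsmooth part `g` is convex and the smooth parts have Lipschitz
gradients, explicit Fréchet subgradients of `Φ` at the iterates are available, and they are bounded
by the last step (`IsInertialProxSeq.exists_norm_energySubgradient_le`). At a cluster point of `x`
the energy values converge to the value of `Φ` there: lower semicontinuity gives one inequality and
the subgradient inequality for `g` the other. Thus the iterates form a descent sequence in the sense
of `IsDescentSeq` (`IsInertialProxSeq.exists_isDescentSeq`), and zero is a limiting subgradient at
the cluster point, so that the Kurdyka–Łojasiewicz property applies there.

*Convergence.* Concavity of `θ` and the inequality of arithmetic and geometric means give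
`2 d (k + 1) ≤ d k + (C / c) (θ (t k) - θ (t (k + 1)))` for suitably indexed step lengths `d` and
energy gaps `t` (`two_mul_step_le_of_kl`). Summation bounds the length of the trajectory and traps
it near the cluster point (`tendsto_of_kl`). If `θ s = M s ^ (1 - κ)`, the gaps satisfy
`t (k + 1) ^ (2 κ) ≤ Q (t k - t (k + 1))`, whence geometric or polynomial decay
(`exists_geometric_bound`, `exists_power_bound`), and the distance to the limit is bounded by a
power of the gap (`IsDescentSeq.eventually_dist_le_rpow`).
-/

/-! ### First-order inequalities -/

section FirstOrder

variable {E : Type*} [NormedAddCommGroup E] [InnerProductSpace ℝ E]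

/-- The derivative of a differentiable function along the segment from `x` to `w`. -/
lemma hasDerivAt_comp_segment [CompleteSpace E] {f : E → ℝ} (hf : Differentiable ℝ f)
    (x w : E) (t : ℝ) :
    HasDerivAt (fun s : ℝ => f (x + s • (w - x)))
      (inner ℝ (gradient f (x + t • (w - x))) (w - x)) t := by
  have h1 : HasDerivAt (fun s : ℝ => x + s • (w - x)) (w - x) t := by
    simpa using ((hasDerivAt_id t).smul_const (w - x)).const_add x
  have h2 := (hf (x + t • (w - x))).hasFDerivAt.comp_hasDerivAt t h1
  rwa [← inner_gradient_left] at h2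

/-- The quadratic error bound for the first-order expansion of a function with Lipschitz
gradient. The factor `1 / 2` is what makes the decrease of the energy strict. -/
lemma abs_sub_sub_inner_gradient_le [CompleteSpace E] {f : E → ℝ} {L : NNReal}
    (hf : Differentiable ℝ f) (hL : LipschitzWith L (gradient f)) (x w : E) :
    |f w - f x - inner ℝ (gradient f x) (w - x)| ≤ L / 2 * ‖w - x‖ ^ 2 := by
  have hψ : ∀ t : ℝ, HasDerivAt
      (fun s : ℝ => f (x + s • (w - x)) - f x - s * inner ℝ (gradient f x) (w - x))
      (inner ℝ (gradient f (x + t • (w - x))) (w - x) - inner ℝ (gradient f x) (w - x)) t := by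
    intro t
    exact (((hasDerivAt_comp_segment hf x w t).sub_const (f x)).sub
      ((hasDerivAt_id t).mul_const (inner ℝ (gradient f x) (w - x)))).congr_deriv
        (by rw [one_mul])
  have hB : ∀ t : ℝ, HasDerivAt (fun s : ℝ => L / 2 * ‖w - x‖ ^ 2 * s ^ 2)
      (L * t * ‖w - x‖ ^ 2) t := by
    intro t
    have := (hasDerivAt_pow 2 t).const_mul ((L : ℝ) / 2 * ‖w - x‖ ^ 2)
    refine this.congr_deriv ?_
    push_cast
    ring
  have key := image_norm_le_of_norm_deriv_right_le_deriv_boundary (a := (0 : ℝ)) (b := 1)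
    (fun t _ => (hψ t).continuousAt.continuousWithinAt)
    (fun t _ => (hψ t).hasDerivWithinAt) (B := fun s : ℝ => L / 2 * ‖w - x‖ ^ 2 * s ^ 2)
    (B' := fun t : ℝ => L * t * ‖w - x‖ ^ 2) (by simp) hB ?_ (right_mem_Icc.2 zero_le_one)
  · simpa using key
  · intro t ht
    rw [← inner_sub_left]
    refine (norm_inner_le_norm _ _).trans ?_
    have h1 : ‖gradient f (x + t • (w - x)) - gradient f x‖ ≤ L * (t * ‖w - x‖) := by
      have := hL.dist_le_mul (x + t • (w - x)) x
      rwa [dist_eq_norm, dist_eq_norm, add_sub_cancel_left, norm_smul, Real.norm_eq_abs,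
        abs_of_nonneg ht.1] at this
    calc _ ≤ L * (t * ‖w - x‖) * ‖w - x‖ := by gcongr
      _ = _ := by ring

/-- A differentiable convex function lies above its tangent hyperplanes. -/
lemma ConvexOn.add_inner_gradient_le [CompleteSpace E] {f : E → ℝ}
    (hc : ConvexOn ℝ univ f) (hf : Differentiable ℝ f) (x w : E) :
    f x + inner ℝ (gradient f x) (w - x) ≤ f w := by
  have h1 : ConvexOn ℝ univ (fun s : ℝ => f (x + s • (w - x))) := by
    have := hc.comp_affineMap (AffineMap.lineMap x w)
    simpa [Function.comp_def, AffineMap.lineMap_apply, add_comm] using this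
  have h2 := h1.le_slope_of_hasDerivAt (mem_univ (0 : ℝ)) (mem_univ (1 : ℝ)) one_pos
    (hasDerivAt_comp_segment hf x w 0)
  simp only [zero_smul, add_zero, one_smul, add_sub_cancel, slope_def_field, sub_zero,
    div_one] at h2
  linarith

/-- First-order optimality for a proximal step: a minimizer `u` of
`g w - ⟪v, w - x⟫ + ‖w - x‖² / (2 λ)` has `v - (u - x) / λ` as a convex subgradient of `g` at `u`.
The subgradient inequality is only asserted at points of the domain of `g`. -/
lemma subgradient_of_prox_minimizer {g : E → EReal} (hg : ∀ x, g x ≠ ⊥) (hc : IsConvexFun g)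
    {lam : ℝ} {x u v : E} (hu : g u ≠ ⊤)
    (hmin : ∀ w, g u + ((-inner ℝ v (u - x) + 1 / (2 * lam) * ‖u - x‖ ^ 2 : ℝ) : EReal) ≤
      g w + ((-inner ℝ v (w - x) + 1 / (2 * lam) * ‖w - x‖ ^ 2 : ℝ) : EReal))
    {w : E} (hw : g w ≠ ⊤) :
    (g u).toReal + inner ℝ (v - (1 / lam) • (u - x)) (w - u) ≤ (g w).toReal := by
  set Gu := (g u).toReal with hGu
  set Gw := (g w).toReal with hGw
  have eu : g u = (Gu : EReal) := (EReal.coe_toReal hu (hg u)).symm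
  have ew : g w = (Gw : EReal) := (EReal.coe_toReal hw (hg w)).symm
  -- Comparing `u` with `u + t (w - u)` and dividing by `t` leaves an error of order `t`.
  have step : ∀ t : ℝ, 0 < t → t < 1 →
      Gu + inner ℝ (v - (1 / lam) • (u - x)) (w - u) ≤
        Gw + t * (1 / (2 * lam) * ‖w - u‖ ^ 2) := by
    intro t ht ht1
    have h1 := (hmin (t • w + (1 - t) • u)).trans
      (add_le_add_left (hc w u t ht ht1) _)
    rw [eu, ew] at h1
    norm_cast at h1
    have e1 : t • w + (1 - t) • u - x = (u - x) + t • (w - u) := by module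
    rw [e1, inner_add_right, inner_smul_right, norm_add_sq_real, inner_smul_right, norm_smul,
      Real.norm_eq_abs, mul_pow, sq_abs] at h1
    rw [inner_sub_left, real_inner_smul_left]
    have h2 : t * (Gu + (inner ℝ v (w - u) - 1 / lam * inner ℝ (u - x) (w - u))) ≤
        t * (Gw + t * (1 / (2 * lam) * ‖w - u‖ ^ 2)) := by
      have e2 : 1 / lam = 2 * (1 / (2 * lam)) := by
        rw [one_div, one_div, mul_inv]; ring
      rw [e2]
      nlinarith [h1]
    exact le_of_mul_le_mul_left h2 ht
  have hlim : Tendsto (fun t : ℝ => Gw + t * (1 / (2 * lam) * ‖w - u‖ ^ 2)) (𝓝[>] 0) (𝓝 Gw) := by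
    have : Continuous (fun t : ℝ => Gw + t * (1 / (2 * lam) * ‖w - u‖ ^ 2)) := by fun_prop
    simpa using (this.tendsto 0).mono_left nhdsWithin_le_nhds
  refine ge_of_tendsto hlim ?_
  filter_upwards [Ioo_mem_nhdsGT one_pos] with t ht using step t ht.1 ht.2

lemma frechetSubdiff_subset_limitingSubdiff (F : E → EReal) (x : E) :
    frechetSubdiff F x ⊆ limitingSubdiff F x := fun v hv =>
  ⟨hv.1, fun _ => x, fun _ => v, tendsto_const_nhds, tendsto_const_nhds, fun _ => hv,
    tendsto_const_nhds⟩

/-- A quadratic lower bound at `x` makes its linear part a Fréchet subgradient. -/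
lemma mem_frechetSubdiff_of_quadratic {F : E → EReal} {x v : E} (hx : F x < ⊤) {Q : ℝ}
    (hQ : 0 < Q)
    (h : ∀ w, F x + ((inner ℝ v (w - x) - Q * ‖w - x‖ ^ 2 : ℝ) : EReal) ≤ F w) :
    v ∈ frechetSubdiff F x := by
  refine ⟨hx, fun ε hε => ?_⟩
  filter_upwards [Metric.ball_mem_nhds x (div_pos hε hQ)] with w hw
  refine le_trans (add_le_add_right (EReal.coe_le_coe_iff.2 ?_) _) (h w)
  rw [Metric.mem_ball, dist_eq_norm, lt_div_iff₀ hQ] at hw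
  nlinarith [norm_nonneg (w - x)]

/-- The Kurdyka–Łojasiewicz inequality at a point where a limiting subgradient of norm at most
`r` is known, written with real numbers. -/
lemma one_le_deriv_mul_of_kl {F : E → EReal} {x v : E} (hv : v ∈ limitingSubdiff F x) {r q : ℝ}
    (hr : ‖v‖ ≤ r) (h : 1 ≤ ENNReal.ofReal q * Metric.infEDist 0 (limitingSubdiff F x)) :
    1 ≤ q * r := by
  have h1 : Metric.infEDist 0 (limitingSubdiff F x) ≤ ENNReal.ofReal r := by
    refine (Metric.infEDist_le_edist_of_mem hv).trans ?_
    rw [edist_dist, dist_zero_left]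
    exact ENNReal.ofReal_le_ofReal hr
  have h2 := h.trans (mul_le_mul_right h1 _)
  rw [← ENNReal.ofReal_mul' ((norm_nonneg v).trans hr), ENNReal.one_le_ofReal] at h2
  exact h2

end FirstOrder

/-! ### Descent sequences under a Kurdyka–Łojasiewicz inequality -/

section KLDescent

/-- One step of the finite-length argument. Concavity of the desingularizing function turns the
decrease `s - s'` of the energy into a decrease of `θ`, and the inequality of arithmetic and
geometric means separates the two consecutive step lengths `d` and `d'`. -/
lemma two_mul_step_le_of_kl {θ : ℝ → ℝ} {ε c C d d' s s' : ℝ} (hθ : ConcaveOn ℝ (Ico 0 ε) θ)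
    (hθd : ∀ t ∈ Ioo 0 ε, DifferentiableAt ℝ θ t) (hc : 0 < c) (hC : 0 < C) (hd : 0 ≤ d)
    (hs' : 0 ≤ s') (hs : s < ε) (hdec : c * d' ^ 2 ≤ s - s')
    (hKL : 0 < s → 1 ≤ deriv θ s * (C * d)) :
    2 * d' ≤ d + (C / c * θ s - C / c * θ s') := by
  have hle : s' ≤ s := by nlinarith [sq_nonneg d']
  rcases (hs'.trans hle).eq_or_lt with h0 | hpos
  · have h1 : s' = s := by linarith
    have h2 : d' = 0 := by
      have : d' ^ 2 ≤ 0 := by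
        by_contra! h
        nlinarith [mul_pos hc h]
      nlinarith
    rw [h1, h2]
    linarith
  · have hp := hKL hpos
    have hconc : deriv θ s * (s - s') ≤ θ s - θ s' := by
      rcases hle.eq_or_lt with h | h
      · simp [h]
      · have := hθ.le_slope_of_hasDerivAt ⟨hs', h.trans hs⟩ ⟨hpos.le, hs⟩ h
          (hθd s ⟨hpos, hs⟩).hasDerivAt
        rwa [slope_def_field, le_div_iff₀ (sub_pos.2 h)] at this
    have hderiv : 0 < deriv θ s := by
      by_contra! h
      nlinarith [mul_nonneg hC.le hd]
    set D := θ s - θ s'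
    have h3 : deriv θ s * (c * d' ^ 2) ≤ D := (mul_le_mul_of_nonneg_left hdec hderiv.le).trans hconc
    have hD : 0 ≤ D := le_trans (by positivity) h3
    have h4 : d' ^ 2 ≤ d * (C / c * D) := by
      have h5 : d * (C / c * (deriv θ s * (c * d' ^ 2))) = deriv θ s * (C * d) * d' ^ 2 := by
        field_simp
      have h6 : d * (C / c * (deriv θ s * (c * d' ^ 2))) ≤ d * (C / c * D) := by gcongr
      nlinarith [sq_nonneg d']
    have h7 : 0 ≤ C / c * D := by positivity
    rw [← mul_sub]
    refine abs_le_of_sq_le_sq' ?_ (by positivity) |>.2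
    nlinarith [sq_nonneg (d - C / c * D)]

lemma sum_add_le_of_two_mul_le {d v : ℕ → ℝ} {K m : ℕ}
    (h : ∀ i < m, 2 * d (K + i + 1) ≤ d (K + i) + (v (K + i) - v (K + i + 1))) :
    ∑ i ∈ Finset.range m, d (K + 1 + i) + d (K + m) ≤ d K + v K - v (K + m) := by
  induction m with
  | zero => simp
  | succ m ih =>
    have h1 := ih fun i hi => h i (hi.trans m.lt_succ_self)
    have h2 := h m m.lt_succ_self
    rw [Finset.sum_range_succ, show K + 1 + m = K + m + 1 by ring,
      show K + (m + 1) = K + m + 1 by ring]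
    linarith

variable {X : Type*} [MetricSpace X] {z : ℕ → X} {zs : X} {t : ℕ → ℝ} {c C ε : ℝ} {θ : ℝ → ℝ}
  {U : Set X}

lemma tendsto_dist_succ_of_decrease (hc : 0 < c)
    (hdec : ∀ k, c * dist (z k) (z (k + 1)) ^ 2 ≤ t k - t (k + 1))
    (ht0 : Tendsto t atTop (𝓝 0)) : Tendsto (fun k => dist (z k) (z (k + 1))) atTop (𝓝 0) := by
  have h1 : Tendsto (fun k => (t k - t (k + 1)) / c) atTop (𝓝 0) := by
    simpa using (ht0.sub ((tendsto_add_atTop_iff_nat 1).2 ht0)).div_const c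
  have h2 : Tendsto (fun k => dist (z k) (z (k + 1)) ^ 2) atTop (𝓝 0) :=
    squeeze_zero (fun _ => sq_nonneg _)
      (fun k => by rw [le_div_iff₀ hc, mul_comm]; exact hdec k) h1
  simpa [Real.sqrt_sq dist_nonneg] using h2.sqrt

/-- As long as the iterates stay in the neighbourhood where the Kurdyka–Łojasiewicz inequality
holds, the length of the trajectory is controlled by its first step and by `θ`. -/
lemma dist_le_of_kl_of_forall_mem (hc : 0 < c) (hC : 0 < C)
    (hdec : ∀ k, c * dist (z k) (z (k + 1)) ^ 2 ≤ t k - t (k + 1)) (ht : ∀ k, 0 ≤ t k)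
    (hθ : ConcaveOn ℝ (Ico 0 ε) θ) (hθ0 : ∀ s ∈ Ico 0 ε, 0 ≤ θ s)
    (hθd : ∀ s ∈ Ioo 0 ε, DifferentiableAt ℝ θ s)
    (hKL : ∀ k, z (k + 1) ∈ U → 0 < t (k + 1) → t (k + 1) < ε →
      1 ≤ deriv θ (t (k + 1)) * (C * dist (z k) (z (k + 1))))
    {K m : ℕ} (htε : ∀ k ≥ K, t k < ε) (hU : ∀ i < m, z (K + 1 + i) ∈ U) :
    dist (z (K + 1)) (z (K + 1 + m)) ≤ dist (z K) (z (K + 1)) + C / c * θ (t (K + 1)) := by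
  have h1 := sum_add_le_of_two_mul_le (d := fun k => dist (z k) (z (k + 1)))
    (v := fun k => C / c * θ (t (k + 1))) (K := K) (m := m) fun i hi => by
      have hm := hU i hi
      rw [show K + 1 + i = K + i + 1 by ring] at hm
      exact two_mul_step_le_of_kl hθ hθd hc hC dist_nonneg (ht _) (htε _ (by omega)) (hdec _)
        fun hpos => hKL _ hm hpos (htε _ (by omega))
  have h2 := dist_le_range_sum_dist (fun i => z (K + 1 + i)) m
  have h3 : 0 ≤ C / c * θ (t (K + m + 1)) :=
    mul_nonneg (by positivity) (hθ0 _ ⟨ht _, htε _ (by omega)⟩)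
  have h4 : 0 ≤ dist (z (K + m)) (z (K + m + 1)) := dist_nonneg
  simp only [add_zero, ← add_assoc] at h1 h2
  linarith

/-- A descent sequence with a cluster point at which the Kurdyka–Łojasiewicz inequality holds
converges to it: once an iterate is close enough to the cluster point, the length bound traps all
later iterates nearby. -/
theorem tendsto_of_kl (hz : MapClusterPt zs atTop z) (hc : 0 < c) (hC : 0 < C)
    (hdec : ∀ k, c * dist (z k) (z (k + 1)) ^ 2 ≤ t k - t (k + 1)) (ht : ∀ k, 0 ≤ t k)
    (ht0 : Tendsto t atTop (𝓝 0)) (hε : 0 < ε) (hθc : ContinuousOn θ (Ico 0 ε)) (hθz : θ 0 = 0)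
    (hθ : ConcaveOn ℝ (Ico 0 ε) θ) (hθ0 : ∀ s ∈ Ico 0 ε, 0 ≤ θ s)
    (hθd : ∀ s ∈ Ioo 0 ε, DifferentiableAt ℝ θ s) (hUn : U ∈ 𝓝 zs)
    (hKL : ∀ k, z (k + 1) ∈ U → 0 < t (k + 1) → t (k + 1) < ε →
      1 ≤ deriv θ (t (k + 1)) * (C * dist (z k) (z (k + 1)))) :
    Tendsto z atTop (𝓝 zs) := by
  obtain ⟨R, hR, hRU⟩ := Metric.mem_nhds_iff.1 hUn
  have htε : ∀ᶠ k in atTop, t k < ε := ht0.eventually_lt_const hε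
  have hd0 := tendsto_dist_succ_of_decrease hc hdec ht0
  have hθt : Tendsto (fun k => θ (t (k + 1))) atTop (𝓝 0) := by
    have h1 : Tendsto (fun k => t (k + 1)) atTop (𝓝[Ico 0 ε] 0) :=
      tendsto_nhdsWithin_iff.2 ⟨(tendsto_add_atTop_iff_nat 1).2 ht0,
        ((tendsto_add_atTop_iff_nat 1).2 ht0).eventually_lt_const hε |>.mono
          fun k hk => ⟨ht _, hk⟩⟩
    have h2 := (hθc 0 ⟨le_rfl, hε⟩).tendsto.comp h1
    rwa [hθz] at h2
  rw [Metric.tendsto_atTop]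
  intro δ hδ
  set r := min δ R
  have hr : 0 < r := lt_min hδ hR
  have hsmall : ∀ᶠ k in atTop, dist (z k) (z (k + 1)) * 2 + C / c * θ (t (k + 1)) < r / 2 := by
    have : Tendsto (fun k => dist (z k) (z (k + 1)) * 2 + C / c * θ (t (k + 1))) atTop (𝓝 0) := by
      simpa using (hd0.mul_const 2).add (hθt.const_mul (C / c))
    exact this.eventually_lt_const (by positivity)
  obtain ⟨K, hKz, hKs, hKε⟩ := ((hz.frequently
    (Metric.ball_mem_nhds zs (half_pos hr))).and_eventually
      (hsmall.and (eventually_forall_ge_atTop.2 htε))).exists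
  have hKz : dist (z K) zs < r / 2 := hKz
  have trap : ∀ m, dist (z (K + 1 + m)) zs < r := by
    intro m
    induction m using Nat.strong_induction_on with
    | _ m ih =>
      have h1 := dist_le_of_kl_of_forall_mem hc hC hdec ht hθ hθ0 hθd hKL hKε
        (m := m) fun i hi => hRU ((ih i hi).trans_le (min_le_right _ _))
      have h2 := dist_triangle4 (z (K + 1 + m)) (z (K + 1)) (z K) zs
      have e1 := dist_comm (z (K + 1 + m)) (z (K + 1))
      have e2 := dist_comm (z (K + 1)) (z K)
      linarith
  refine ⟨K + 1, fun k hk => ?_⟩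
  obtain ⟨m, rfl⟩ := Nat.exists_eq_add_of_le hk
  exact (trap m).trans_le (min_le_left _ _)

/-- The distance to the limit is controlled by the last step and by `θ`. -/
theorem eventually_dist_limit_le_of_kl (hz : Tendsto z atTop (𝓝 zs)) (hc : 0 < c) (hC : 0 < C)
    (hdec : ∀ k, c * dist (z k) (z (k + 1)) ^ 2 ≤ t k - t (k + 1)) (ht : ∀ k, 0 ≤ t k)
    (ht0 : Tendsto t atTop (𝓝 0)) (hε : 0 < ε)
    (hθ : ConcaveOn ℝ (Ico 0 ε) θ) (hθ0 : ∀ s ∈ Ico 0 ε, 0 ≤ θ s)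
    (hθd : ∀ s ∈ Ioo 0 ε, DifferentiableAt ℝ θ s) (hUn : U ∈ 𝓝 zs)
    (hKL : ∀ k, z (k + 1) ∈ U → 0 < t (k + 1) → t (k + 1) < ε →
      1 ≤ deriv θ (t (k + 1)) * (C * dist (z k) (z (k + 1)))) :
    ∀ᶠ k in atTop,
      dist (z (k + 1)) zs ≤ dist (z k) (z (k + 1)) + C / c * θ (t (k + 1)) := by
  filter_upwards [eventually_forall_ge_atTop.2 (ht0.eventually_lt_const hε),
    eventually_forall_ge_atTop.2 (hz.eventually_mem hUn)] with K hKε hKU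
  have hlim : Tendsto (fun m => dist (z (K + 1)) (z (K + 1 + m))) atTop
      (𝓝 (dist (z (K + 1)) zs)) := by
    refine tendsto_const_nhds.dist (hz.comp ?_)
    exact tendsto_atTop_mono (fun m => Nat.le_add_left m (K + 1)) tendsto_id
  exact le_of_tendsto' hlim fun m => dist_le_of_kl_of_forall_mem hc hC hdec ht hθ hθ0 hθd hKL
    hKε fun i _ => hKU _ (by omega)

end KLDescent

/-! ### Rates of convergence -/

section Rates

/-- An eventual bound `e (k + m) ≤ A * v k` by a positive sequence that loses at most a constant
factor under the shift extends to all indices from `k₀` on, after enlarging the constant. -/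
lemma exists_forall_le_of_eventually {e v : ℕ → ℝ} {A B : ℝ} {k₀ m : ℕ}
    (hv : ∀ k ≥ k₀, 0 < v k) (hA : 0 ≤ A) (hB : ∀ k ≥ k₀, v k ≤ B * v (k + m))
    (h : ∀ᶠ k in atTop, e (k + m) ≤ A * v k) :
    ∃ A' : ℝ, 0 < A' ∧ ∀ k ≥ k₀, e k ≤ A' * v k := by
  obtain ⟨N, hN⟩ := eventually_atTop.1 h
  set N' := max N k₀ + m
  have hsum : 0 ≤ ∑ i ∈ Finset.range N', |e i / v i| := Finset.sum_nonneg fun _ _ => abs_nonneg _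
  refine ⟨A * |B| + 1 + ∑ i ∈ Finset.range N', |e i / v i|, by positivity, fun k hk => ?_⟩
  have hvk := hv k hk
  rcases lt_or_ge k N' with hlt | hge
  · have h1 : |e k / v k| ≤ ∑ i ∈ Finset.range N', |e i / v i| :=
      Finset.single_le_sum (f := fun i => |e i / v i|) (fun _ _ => abs_nonneg _)
        (Finset.mem_range.2 hlt)
    have h2 : e k ≤ |e k / v k| * v k := by
      rw [← div_le_iff₀ hvk]
      exact le_abs_self _
    refine h2.trans (mul_le_mul_of_nonneg_right ?_ hvk.le)
    have : 0 ≤ A * |B| := by positivity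
    linarith
  · obtain ⟨j, rfl⟩ := Nat.exists_eq_add_of_le' ((Nat.le_add_left m _).trans hge)
    have hj : max N k₀ ≤ j := by omega
    have hj0 : k₀ ≤ j := (le_max_right _ _).trans hj
    have h1 := hN j ((le_max_left _ _).trans hj)
    have h2 : v j ≤ |B| * v (j + m) :=
      (hB j hj0).trans (mul_le_mul_of_nonneg_right (le_abs_self B) hvk.le)
    calc e (j + m) ≤ A * v j := h1
      _ ≤ A * (|B| * v (j + m)) := by gcongr
      _ ≤ _ := by
        rw [← mul_assoc]
        refine mul_le_mul_of_nonneg_right ?_ hvk.le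
        linarith

lemma exists_geometric_bound {t : ℕ → ℝ} {Q : ℝ} (hQ : 0 < Q) (ht : ∀ k, 0 ≤ t k)
    (h : ∀ᶠ k in atTop, t (k + 1) ≤ Q * (t k - t (k + 1))) :
    ∃ A ζ : ℝ, 0 ≤ A ∧ 0 < ζ ∧ ζ < 1 ∧ ∀ᶠ k in atTop, t k ≤ A * ζ ^ k := by
  obtain ⟨N, hN⟩ := eventually_atTop.1 h
  have hζ : 0 < Q / (1 + Q) := by positivity
  refine ⟨t N / (Q / (1 + Q)) ^ N, Q / (1 + Q), div_nonneg (ht N) (by positivity), hζ,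
    by rw [div_lt_one (by positivity)]; linarith, ?_⟩
  filter_upwards [eventually_ge_atTop N] with k hk
  induction k, hk using Nat.le_induction with
  | base => rw [div_mul_cancel₀ _ (by positivity)]
  | succ k hk ih =>
    have h1 : t (k + 1) ≤ Q / (1 + Q) * t k := by
      rw [div_mul_eq_mul_div, le_div_iff₀ (by positivity)]
      linarith [hN k hk]
    calc t (k + 1) ≤ Q / (1 + Q) * t k := h1
      _ ≤ Q / (1 + Q) * (t N / (Q / (1 + Q)) ^ N * (Q / (1 + Q)) ^ k) := by gcongr
      _ = _ := by ring

lemma one_add_rpow_le {q s : ℝ} (hq : 0 ≤ q) (hs : 0 ≤ s) (hs1 : s ≤ 1) :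
    (1 + s) ^ q ≤ 1 + q * s * Real.exp q := by
  have h1 : (1 + s) ^ q ≤ Real.exp (q * s) := by
    rw [mul_comm, Real.exp_mul]
    exact Real.rpow_le_rpow (by positivity) (by linarith [Real.add_one_le_exp s]) hq
  have h2 : Real.exp (q * s) ≤ 1 + q * s * Real.exp (q * s) := by
    have h3 := Real.add_one_le_exp (-(q * s))
    have h4 : Real.exp (-(q * s)) * Real.exp (q * s) = 1 := by
      rw [← Real.exp_add]; simp
    nlinarith [Real.exp_pos (q * s)]
  have h5 : Real.exp (q * s) ≤ Real.exp q := Real.exp_le_exp.2 (by nlinarith)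
  have : 0 ≤ q * s := by positivity
  nlinarith

/-- A nonnegative sequence with `t (k + 1) ^ p ≤ Q (t k - t (k + 1))`, `p > 1`, decays like
`k ^ (-1 / (p - 1))`, the rate of the differential equation `t' = -t ^ p / Q`. -/
lemma exists_power_bound {t : ℕ → ℝ} {Q p : ℝ} (hQ : 0 < Q) (hp : 1 < p)
    (h : ∀ᶠ k in atTop, t (k + 1) ^ p ≤ Q * (t k - t (k + 1))) :
    ∃ A : ℝ, 0 ≤ A ∧ ∀ᶠ k : ℕ in atTop, t k ≤ A * (k : ℝ) ^ (-(1 / (p - 1))) := by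
  obtain ⟨N₀, hN₀⟩ := eventually_atTop.1 h
  have hp1 : 0 < p - 1 := by linarith
  set q := 1 / (p - 1) with hq
  have hqpos : 0 < q := by positivity
  set N := max N₀ 1
  have hNpos : (0 : ℝ) < N := by
    exact_mod_cast (le_max_right N₀ 1)
  -- The second entry makes `A ^ (p - 1) ≥ 2 Q q exp q`, which closes the induction step.
  set A := max (t N * (N : ℝ) ^ q) ((2 * Q * q * Real.exp q) ^ q) with hA
  have hApos : 0 < A := lt_of_lt_of_le (by positivity) (le_max_right _ _)
  have hAp : 2 * Q * q * Real.exp q ≤ A ^ (p - 1) := by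
    have h1 : ((2 * Q * q * Real.exp q) ^ q) ^ (p - 1) ≤ A ^ (p - 1) :=
      Real.rpow_le_rpow (by positivity) (le_max_right _ _) hp1.le
    rwa [← Real.rpow_mul (by positivity), hq, one_div_mul_cancel hp1.ne', Real.rpow_one] at h1
  refine ⟨A, hApos.le, ?_⟩
  filter_upwards [eventually_ge_atTop N] with k hk
  induction k, hk using Nat.le_induction with
  | base =>
    rw [Real.rpow_neg hNpos.le, ← div_eq_mul_inv, le_div_iff₀ (by positivity)]
    exact le_max_left _ _
  | succ k hk ih =>
    by_contra! hcon
    have hk1 : (1 : ℝ) ≤ k := by exact_mod_cast (le_max_right N₀ 1).trans hk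
    have hrec := hN₀ k ((le_max_left N₀ 1).trans hk)
    push_cast at hcon
    set w : ℝ := ((k : ℝ) + 1) ^ (-q) with hw
    have hwpos : 0 < w := by positivity
    have h1 : A * w * (A ^ (p - 1) * ((k : ℝ) + 1)⁻¹) ≤ t (k + 1) ^ p := by
      have e1 : A * w * (A ^ (p - 1) * ((k : ℝ) + 1)⁻¹) = (A * w) ^ p := by
        have e2 : w ^ (p - 1) = ((k : ℝ) + 1)⁻¹ := by
          rw [hw, ← Real.rpow_mul (by positivity), hq, neg_mul, one_div_mul_cancel hp1.ne',
            Real.rpow_neg_one]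
        rw [← e2, Real.mul_rpow hApos.le hwpos.le, show p = 1 + (p - 1) by ring,
          Real.rpow_add hApos, Real.rpow_add hwpos, Real.rpow_one, Real.rpow_one]
        ring_nf
      rw [e1]
      exact Real.rpow_le_rpow (by positivity) hcon.le (by linarith)
    have h2 : (k : ℝ) ^ (-q) ≤ w * (1 + q * (k : ℝ)⁻¹ * Real.exp q) := by
      have e1 : (k : ℝ) ^ (-q) = w * (1 + (k : ℝ)⁻¹) ^ q := by
        have e2 : 1 + (k : ℝ)⁻¹ = ((k : ℝ) + 1) * (k : ℝ)⁻¹ := by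
          field_simp
        rw [e2, Real.mul_rpow (by positivity) (by positivity), hw, ← mul_assoc,
          ← Real.rpow_add (by positivity), neg_add_cancel, Real.rpow_zero, one_mul,
          Real.inv_rpow (by positivity), Real.rpow_neg (by positivity)]
      rw [e1]
      gcongr
      exact one_add_rpow_le hqpos.le (by positivity) (inv_le_one_of_one_le₀ hk1)
    have h3 : A * w * (A ^ (p - 1) * ((k : ℝ) + 1)⁻¹) <
        A * w * (Q * q * Real.exp q * (k : ℝ)⁻¹) := by
      calc _ ≤ Q * (t k - t (k + 1)) := h1.trans hrec
        _ < Q * (A * (w * (1 + q * (k : ℝ)⁻¹ * Real.exp q)) - A * w) := by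
          refine mul_lt_mul_of_pos_left ?_ hQ
          have := mul_le_mul_of_nonneg_left h2 hApos.le
          linarith
        _ = _ := by ring
    have h4 := lt_of_mul_lt_mul_left h3 (by positivity)
    have h5 : Q * q * Real.exp q * (k : ℝ)⁻¹ ≤ A ^ (p - 1) * ((k : ℝ) + 1)⁻¹ := by
      rw [← div_eq_mul_inv, ← div_eq_mul_inv, div_le_div_iff₀ (by positivity) (by positivity)]
      have : 0 ≤ Q * q * Real.exp q := by positivity
      nlinarith
    linarith

variable {X : Type*} [MetricSpace X] {z : ℕ → X} {zs : X} {t : ℕ → ℝ} {c C M κ : ℝ}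

/-- If the energy gap of a convergent descent sequence vanishes eventually, the sequence is
eventually constant. -/
lemma eventually_eq_of_eventually_gap_eq_zero (hz : Tendsto z atTop (𝓝 zs)) (hc : 0 < c)
    (hdec : ∀ k, c * dist (z k) (z (k + 1)) ^ 2 ≤ t k - t (k + 1))
    (h : ∀ᶠ k in atTop, t k = 0) : ∀ᶠ k in atTop, z k = zs := by
  obtain ⟨K, hK⟩ := eventually_atTop.1 h
  have hstep : ∀ k ≥ K, z (k + 1) = z k := by
    intro k hk
    have h1 := hdec k
    rw [hK k hk, hK (k + 1) (by omega), sub_zero] at h1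
    have h2 : dist (z k) (z (k + 1)) ^ 2 = 0 :=
      le_antisymm (nonpos_of_mul_nonpos_right h1 hc) (sq_nonneg _)
    exact (dist_eq_zero.1 (pow_eq_zero_iff two_ne_zero |>.1 h2)).symm
  have hconst : ∀ k ≥ K, z k = z K := by
    intro k hk
    induction k, hk using Nat.le_induction with
    | base => rfl
    | succ k hk ih => rw [hstep k hk, ih]
  have hlim : z K = zs := tendsto_nhds_unique
    (tendsto_const_nhds.congr' ((eventually_ge_atTop K).mono fun k hk => (hconst k hk).symm)) hz
  filter_upwards [eventually_ge_atTop K] with k hk using (hconst k hk).trans hlim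

lemma deriv_const_mul_rpow_one_sub {s : ℝ} (hs : 0 < s) :
    deriv (fun r : ℝ => M * r ^ (1 - κ)) s = M * (1 - κ) * s ^ (-κ) := by
  rw [((Real.hasDerivAt_rpow_const (p := 1 - κ) (Or.inl hs.ne')).const_mul M).deriv]
  rw [show 1 - κ - 1 = -κ by ring, mul_assoc]

/-- The Łojasiewicz inequality along the sequence: with `θ s = M s ^ (1 - κ)`, the power `κ` of
the gap is bounded by the step length. -/
lemma rpow_gap_le_of_kl {s d : ℝ} (hM : 0 < M) (hκ : 0 ≤ κ) (hd : 0 ≤ d) (hs : 0 < s)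
    (h : 1 ≤ deriv (fun r : ℝ => M * r ^ (1 - κ)) s * d) : s ^ κ ≤ M * d := by
  rw [deriv_const_mul_rpow_one_sub hs, Real.rpow_neg hs.le] at h
  have h1 : 0 < s ^ κ := by positivity
  have h2 : M * (1 - κ) * (s ^ κ)⁻¹ * d = M * (1 - κ) * d / s ^ κ := by ring
  rw [h2, le_div_iff₀ h1, one_mul] at h
  have : 0 ≤ M * d * κ := by positivity
  linarith

end Rates

/-! ### The abstract convergence theorem for descent methods -/

section DescentSeq

variable {E : Type*} [NormedAddCommGroup E] [InnerProductSpace ℝ E]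

/-- A descent sequence for `F` with cluster point `zs`: sufficient decrease of `F` along `z` with
constant `c`, subgradients controlled by the last step with constant `C`, and convergence of the
values to the finite value `Fs` of `F` at `zs`. The gap `F (z k) - Fs` is recorded as the real
number `t k`. -/
structure IsDescentSeq (F : E → EReal) (z : ℕ → E) (zs : E) (Fs : ℝ) (t : ℕ → ℝ)
    (c C : ℝ) : Prop where
  c_pos : 0 < c
  C_pos : 0 < C
  cluster : MapClusterPt zs atTop z
  value_limit : F zs = (Fs : EReal)
  value : ∀ k, F (z k) = ((Fs + t k : ℝ) : EReal)
  decrease : ∀ k, c * dist (z k) (z (k + 1)) ^ 2 ≤ t k - t (k + 1)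
  gap_nonneg : ∀ k, 0 ≤ t k
  gap_tendsto : Tendsto t atTop (𝓝 0)
  subgradient : ∀ k, ∃ v ∈ limitingSubdiff F (z (k + 1)), ‖v‖ ≤ C * dist (z k) (z (k + 1))

namespace IsDescentSeq

variable {F : E → EReal} {z : ℕ → E} {zs : E} {Fs : ℝ} {t : ℕ → ℝ} {c C : ℝ} {θ : ℝ → ℝ}

/-- The Kurdyka–Łojasiewicz inequality at the cluster point, evaluated along the sequence. -/
lemma kl_along (hs : IsDescentSeq F z zs Fs t c C) {U : Set E} {ε : ℝ}
    (h : ∀ x ∈ U, F zs < F x → F x < F zs + (ε : EReal) →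
      1 ≤ ENNReal.ofReal (deriv θ (F x - F zs).toReal) *
        Metric.infEDist 0 (limitingSubdiff F x)) (k : ℕ) (hU : z (k + 1) ∈ U)
    (h0 : 0 < t (k + 1)) (hε : t (k + 1) < ε) :
    1 ≤ deriv θ (t (k + 1)) * (C * dist (z k) (z (k + 1))) := by
  obtain ⟨v, hv, hvn⟩ := hs.subgradient k
  have h1 := h (z (k + 1)) hU
  rw [hs.value_limit, hs.value (k + 1)] at h1
  norm_cast at h1
  have h2 := h1 (by linarith) (by linarith)
  rw [EReal.toReal_coe, add_sub_cancel_left] at h2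
  exact one_le_deriv_mul_of_kl hv hvn h2

theorem tendsto (hs : IsDescentSeq F z zs Fs t c C) (hKL : KLInequalityAt F zs θ) :
    Tendsto z atTop (𝓝 zs) := by
  obtain ⟨ε, hε, U, hU, hθc, hθ, hθ0, hθz, -, hθd, h⟩ := hKL
  exact tendsto_of_kl hs.cluster hs.c_pos hs.C_pos hs.decrease hs.gap_nonneg hs.gap_tendsto hε hθc
    hθz hθ hθ0 (fun s hs => (hθd.differentiableOn one_ne_zero).differentiableAt
      (isOpen_Ioo.mem_nhds hs)) hU (hs.kl_along h)

lemma eventually_dist_le (hs : IsDescentSeq F z zs Fs t c C) (hKL : KLInequalityAt F zs θ) :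
    ∀ᶠ k in atTop,
      dist (z (k + 1)) zs ≤ dist (z k) (z (k + 1)) + C / c * θ (t (k + 1)) := by
  have hz := hs.tendsto hKL
  obtain ⟨ε, hε, U, hU, hθc, hθ, hθ0, hθz, -, hθd, h⟩ := hKL
  exact eventually_dist_limit_le_of_kl hz hs.c_pos hs.C_pos hs.decrease hs.gap_nonneg
    hs.gap_tendsto hε hθ hθ0 (fun s hs => (hθd.differentiableOn one_ne_zero).differentiableAt
      (isOpen_Ioo.mem_nhds hs)) hU (hs.kl_along h)

variable {M κ : ℝ}

lemma eventually_rpow_gap_le (hs : IsDescentSeq F z zs Fs t c C) (hM : 0 < M) (hκ : 0 ≤ κ)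
    (hKL : KLInequalityAt F zs (fun s : ℝ => M * s ^ (1 - κ))) :
    ∀ᶠ k in atTop, 0 < t (k + 1) →
      t (k + 1) ^ κ ≤ M * (C * dist (z k) (z (k + 1))) := by
  have hz := hs.tendsto hKL
  obtain ⟨ε, hε, U, hU, -, -, -, -, -, -, h⟩ := hKL
  filter_upwards [((tendsto_add_atTop_iff_nat 1).2 hz).eventually_mem hU,
    ((tendsto_add_atTop_iff_nat 1).2 hs.gap_tendsto).eventually_lt_const hε] with k hkU hkε hk0
  exact rpow_gap_le_of_kl hM hκ (mul_nonneg hs.C_pos.le dist_nonneg) hk0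
    (hs.kl_along h k hkU hk0 hkε)

/-- Exponent `κ = 0`: subgradients at points with a positive gap are bounded away from zero,
whereas the step lengths tend to zero. -/
theorem finite_termination (hs : IsDescentSeq F z zs Fs t c C) (hM : 0 < M) (hκ : κ = 0)
    (hKL : KLInequalityAt F zs (fun s : ℝ => M * s ^ (1 - κ))) :
    ∀ᶠ k in atTop, z k = zs := by
  have hz := hs.tendsto hKL
  refine eventually_eq_of_eventually_gap_eq_zero hz hs.c_pos hs.decrease ?_
  have hd : Tendsto (fun k => M * (C * dist (z k) (z (k + 1)))) atTop (𝓝 0) := by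
    simpa using ((hz.dist ((tendsto_add_atTop_iff_nat 1).2 hz)).const_mul C).const_mul M
  have h1 : ∀ᶠ k in atTop, t (k + 1) = 0 := by
    filter_upwards [hs.eventually_rpow_gap_le hM hκ.ge hKL, hd.eventually_lt_const one_pos]
      with k hk hk1
    by_contra hne
    have := hk ((hs.gap_nonneg _).lt_of_ne' hne)
    rw [hκ, Real.rpow_zero] at this
    linarith
  obtain ⟨K, hK⟩ := eventually_atTop.1 h1
  filter_upwards [eventually_ge_atTop (K + 1)] with k hk
  obtain ⟨j, rfl⟩ := Nat.exists_eq_add_of_le' hk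
  exact hK (j + K) (by omega)

lemma eventually_gap_recursion (hs : IsDescentSeq F z zs Fs t c C) (hM : 0 < M) (hκ : 0 < κ)
    (hKL : KLInequalityAt F zs (fun s : ℝ => M * s ^ (1 - κ))) :
    ∀ᶠ k in atTop, t (k + 1) ^ (2 * κ) ≤ (M * C) ^ 2 / c * (t k - t (k + 1)) := by
  filter_upwards [hs.eventually_rpow_gap_le hM hκ.le hKL] with k hk
  have h0 := hs.gap_nonneg (k + 1)
  have hc := hs.c_pos
  have hC := hs.C_pos
  have h1 : t (k + 1) ^ κ ≤ M * (C * dist (z k) (z (k + 1))) := by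
    rcases h0.eq_or_lt with h | h
    · rw [← h, Real.zero_rpow hκ.ne']
      positivity
    · exact hk h
  have h2 : t (k + 1) ^ (2 * κ) = (t (k + 1) ^ κ) ^ 2 := by
    rw [mul_comm, Real.rpow_mul h0, Real.rpow_two]
  calc t (k + 1) ^ (2 * κ) ≤ (M * (C * dist (z k) (z (k + 1)))) ^ 2 := by
        rw [h2]
        exact pow_le_pow_left₀ (Real.rpow_nonneg h0 _) h1 2
    _ = (M * C) ^ 2 / c * (c * dist (z k) (z (k + 1)) ^ 2) := by
        field_simp
    _ ≤ _ := by
        gcongr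
        exact hs.decrease k

/-- The distance to the limit is controlled by a power of the gap. -/
lemma eventually_dist_le_rpow (hs : IsDescentSeq F z zs Fs t c C) (hM : 0 < M)
    (hKL : KLInequalityAt F zs (fun s : ℝ => M * s ^ (1 - κ))) {s : ℝ} (hs0 : 0 < s)
    (hs2 : s ≤ 1 / 2) (hsκ : s ≤ 1 - κ) :
    ∃ B : ℝ, 0 ≤ B ∧ ∀ᶠ k in atTop, dist (z (k + 1)) zs ≤ B * t k ^ s := by
  have hc := hs.c_pos
  have hC := hs.C_pos
  refine ⟨√(1 / c) + C / c * M, by positivity, ?_⟩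
  filter_upwards [hs.eventually_dist_le hKL, hs.gap_tendsto.eventually_lt_const one_pos]
    with k hk hk1
  have h0 := hs.gap_nonneg k
  have h0' := hs.gap_nonneg (k + 1)
  have hdec := hs.decrease k
  have hle : t (k + 1) ≤ t k := by nlinarith [sq_nonneg (dist (z k) (z (k + 1)))]
  -- Smaller exponents give larger powers, because the gap is less than one.
  have hpow : ∀ e, s ≤ e → t k ^ e ≤ t k ^ s := fun e he =>
    Real.rpow_le_rpow_of_exponent_ge_of_imp h0 hk1.le he (fun _ h => absurd h (hs0.trans_le he).ne')
  have h1 : dist (z k) (z (k + 1)) ≤ √(1 / c) * t k ^ s := by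
    calc dist (z k) (z (k + 1)) ≤ √(1 / c * t k) := by
          refine Real.le_sqrt_of_sq_le ?_
          rw [one_div, ← div_eq_inv_mul, le_div_iff₀ hc]
          linarith
      _ = √(1 / c) * t k ^ (1 / 2 : ℝ) := by
          rw [Real.sqrt_mul (by positivity), Real.sqrt_eq_rpow (t k)]
      _ ≤ _ := by
          exact mul_le_mul_of_nonneg_left (hpow _ hs2) (Real.sqrt_nonneg _)
  have h2 : t (k + 1) ^ (1 - κ) ≤ t k ^ s :=
    (Real.rpow_le_rpow h0' hle (by linarith)).trans (hpow _ hsκ)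
  calc dist (z (k + 1)) zs ≤ dist (z k) (z (k + 1)) + C / c * (M * t (k + 1) ^ (1 - κ)) := hk
    _ ≤ √(1 / c) * t k ^ s + C / c * (M * t k ^ s) := by gcongr
    _ = _ := by ring

theorem linear_rate (hs : IsDescentSeq F z zs Fs t c C) (hM : 0 < M) (hκ : 0 < κ)
    (hκ2 : κ ≤ 1 / 2) (hKL : KLInequalityAt F zs (fun s : ℝ => M * s ^ (1 - κ))) :
    ∃ A ζ : ℝ, 0 ≤ A ∧ 0 < ζ ∧ ζ < 1 ∧ ∀ᶠ k in atTop, dist (z (k + 1)) zs ≤ A * ζ ^ k := by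
  have hc := hs.c_pos
  have hC := hs.C_pos
  obtain ⟨A, ζ, hA, hζ, hζ1, hgeo⟩ := exists_geometric_bound (t := t)
    (Q := (M * C) ^ 2 / c) (by positivity) hs.gap_nonneg (by
      filter_upwards [hs.eventually_gap_recursion hM hκ hKL,
        ((tendsto_add_atTop_iff_nat 1).2 hs.gap_tendsto).eventually_lt_const one_pos]
        with k hk hk1
      refine le_trans ?_ hk
      have := Real.rpow_le_rpow_of_exponent_ge_of_imp (hs.gap_nonneg (k + 1)) hk1.le
        (show 2 * κ ≤ 1 by linarith) (fun _ h => absurd h (by positivity))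
      rwa [Real.rpow_one] at this)
  obtain ⟨B, hB, hdist⟩ := hs.eventually_dist_le_rpow hM hKL (s := 1 / 2) (by norm_num) le_rfl
    (by linarith)
  refine ⟨B * A ^ (1 / 2 : ℝ), ζ ^ (1 / 2 : ℝ), by positivity, by positivity,
    Real.rpow_lt_one hζ.le hζ1 (by norm_num), ?_⟩
  filter_upwards [hgeo, hdist] with k hk hkd
  refine hkd.trans ?_
  rw [mul_assoc, ← Real.rpow_mul_natCast hζ.le, mul_comm (1 / 2 : ℝ) (k : ℝ),
    Real.rpow_natCast_mul hζ.le, ← Real.mul_rpow hA (by positivity)]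
  gcongr
  exact hs.gap_nonneg k

theorem sublinear_rate (hs : IsDescentSeq F z zs Fs t c C) (hM : 0 < M) (hκ : 1 / 2 < κ)
    (hκ1 : κ < 1) (hKL : KLInequalityAt F zs (fun s : ℝ => M * s ^ (1 - κ))) :
    ∃ A : ℝ, 0 ≤ A ∧
      ∀ᶠ k : ℕ in atTop, dist (z (k + 1)) zs ≤ A * (k : ℝ) ^ ((1 - κ) / (1 - 2 * κ)) := by
  have hc := hs.c_pos
  have hC := hs.C_pos
  obtain ⟨A, hA, hpow⟩ := exists_power_bound (t := t) (Q := (M * C) ^ 2 / c) (p := 2 * κ)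
    (by positivity) (by linarith) (hs.eventually_gap_recursion hM (by linarith) hKL)
  obtain ⟨B, hB, hdist⟩ := hs.eventually_dist_le_rpow hM hKL (s := 1 - κ) (by linarith)
    (by linarith) le_rfl
  refine ⟨B * A ^ (1 - κ), by positivity, ?_⟩
  filter_upwards [hpow, hdist] with k hk hkd
  refine hkd.trans ?_
  have e1 : (1 - κ) / (1 - 2 * κ) = -(1 / (2 * κ - 1)) * (1 - κ) := by
    rw [show 1 - 2 * κ = -(2 * κ - 1) by ring, div_neg]
    ring
  rw [mul_assoc, e1, Real.rpow_mul (by positivity), ← Real.mul_rpow hA (by positivity)]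
  have := hs.gap_nonneg k
  gcongr

end IsDescentSeq

end DescentSeq

/-! ### The parameters of the method -/

namespace InertialParams

variable {p : InertialParams}

lemma ρ_pos (hβ : 0 < p.β) (hτ : -(2 + p.α) / (2 * p.β) < p.τ) : 0 < p.ρ := by
  rw [div_lt_iff₀ (by positivity)] at hτ
  unfold ρ
  nlinarith

lemma b₂_pos (hβ : 0 < p.β) (hαβ : 0 < p.α + p.β) (hτ : -(2 + p.α) / (2 * p.β) < p.τ) :
    0 < p.b₂ := by
  rw [div_lt_iff₀ (by positivity)] at hτ
  have hs : 0 < 2 + p.α + p.β := by linarith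
  have hb : 0 < p.b := by unfold b; positivity
  refine mul_pos hb ?_
  have e : 1 + p.b * (p.τ - 1 / 2) = (2 + p.α + 2 * p.β * p.τ) / (2 + p.α + p.β) := by
    unfold b
    field_simp
    ring
  rw [e]
  exact div_pos (by linarith) hs

lemma δ₁_pos (hβ : 0 < p.β) (hτ : -(2 + p.α) / (2 * p.β) < p.τ) (hlam : 0 < p.lam)
    (hmu : 0 < p.mu) (hδ : 0 < p.a₂ + p.b₂) : 0 < p.δ₁ :=
  mul_pos hδ (div_pos hlam (mul_pos (ρ_pos hβ hτ) hmu))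

variable {E : Type*} [NormedAddCommGroup E] [InnerProductSpace ℝ E]

/-- `a x + b y` is a multiple of the inertial combination `α x + β y`. -/
lemma a_smul_add_b_smul (p : InertialParams) (x y : E) :
    p.a • x + p.b • y = (2 / (2 + p.α + p.β)) • (p.α • x + p.β • y) := by
  unfold a b
  module

/-- The exact change of the quadratic part of the energy in one step of the method. -/
lemma half_norm_sq_step (hs : 0 < 2 + p.α + p.β) {x y x' y' : E}
    (hy : p.α • x + p.β • y = -(p.ρ • (y' - y)) - (p.γ * p.α) • (x' - x)) :
    1 / 2 * ‖p.a • x' + p.b • y'‖ ^ 2 = 1 / 2 * ‖p.a • x + p.b • y‖ ^ 2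
      - p.a ^ 2 * (p.γ - 1 / 2) * ‖x' - x‖ ^ 2 - p.a₂ * inner ℝ (x' - x) (y' - y)
      - p.b₂ * ‖y' - y‖ ^ 2 := by
  have e1 : p.a • x' + p.b • y' = (p.a • x + p.b • y) + (p.a • (x' - x) + p.b • (y' - y)) := by
    module
  rw [e1, norm_add_sq_real, a_smul_add_b_smul, hy, ← real_inner_self_eq_norm_sq,
    ← real_inner_self_eq_norm_sq, ← real_inner_self_eq_norm_sq, ← real_inner_self_eq_norm_sq]
  generalize x' - x = X
  generalize y' - y = Y
  simp only [inner_add_left, inner_add_right, inner_sub_left, inner_sub_right, inner_neg_left,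
    inner_neg_right, real_inner_smul_left, real_inner_smul_right, real_inner_comm X Y]
  unfold a₂ b₂ a b ρ
  field_simp
  ring

/-- The quadratic form of the sufficient decrease becomes positive definite after adding an
arbitrarily small multiple of `‖X‖ ^ 2`. -/
lemma exists_coercive {A B e : ℝ} (hB : 0 < B) (he : 0 < e) (hAB : 0 ≤ 4 * A + 3 * B) :
    ∃ c : ℝ, 0 < c ∧ ∀ X Y : E, c * (‖X‖ ^ 2 + ‖Y‖ ^ 2) ≤
      1 / 2 * (2 * A + B) * ‖X‖ ^ 2 + B / 2 * ‖Y‖ ^ 2 + B / 2 * ‖X - Y‖ ^ 2 + e * ‖X‖ ^ 2 := by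
  -- The cross term is absorbed with `⟪X, Y⟫ ≤ η ‖X‖² + ‖Y‖² / (4 η)`, where `1/4 < η < D / B`.
  set D := A + B + e with hD
  have hDB : B < 4 * D := by linarith
  obtain ⟨η, hη1, hη2⟩ := exists_between (show (1 / 4 : ℝ) < D / B by
    rw [lt_div_iff₀ hB]; linarith)
  have hη : 0 < η := by linarith
  rw [lt_div_iff₀ hB] at hη2
  have hY : 0 < B * (1 - 1 / (4 * η)) := by
    refine mul_pos hB (sub_pos.2 ?_)
    rw [div_lt_one (by positivity)]
    linarith
  refine ⟨min (D - η * B) (B * (1 - 1 / (4 * η))), lt_min (by linarith) hY, fun X Y => ?_⟩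
  have h1 : 0 ≤ ‖(2 * η) • X - Y‖ ^ 2 := sq_nonneg _
  rw [norm_sub_sq_real, real_inner_smul_left, norm_smul, Real.norm_eq_abs, mul_pow, sq_abs] at h1
  have h2 : inner ℝ X Y ≤ η * ‖X‖ ^ 2 + 1 / (4 * η) * ‖Y‖ ^ 2 := by
    have h3 : 4 * η * inner ℝ X Y ≤ 4 * η * (η * ‖X‖ ^ 2 + 1 / (4 * η) * ‖Y‖ ^ 2) := by
      have : 4 * η * (η * ‖X‖ ^ 2 + 1 / (4 * η) * ‖Y‖ ^ 2) = 4 * η ^ 2 * ‖X‖ ^ 2 + ‖Y‖ ^ 2 := by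
        field_simp
      rw [this]
      linarith
    exact le_of_mul_le_mul_left h3 (by positivity)
  rw [norm_sub_sq_real]
  have h4 := mul_le_mul_of_nonneg_left h2 hB.le
  have h5 := mul_le_mul_of_nonneg_right (min_le_left (D - η * B) (B * (1 - 1 / (4 * η))))
    (sq_nonneg ‖X‖)
  have h6 := mul_le_mul_of_nonneg_right (min_le_right (D - η * B) (B * (1 - 1 / (4 * η))))
    (sq_nonneg ‖Y‖)
  rw [hD] at h5 h6 ⊢
  linarith

end InertialParams

/-! ### The energy -/

section Energy

variable {n : ℕ}

/-- The energy at `(x, y)` as a real number. It agrees with `energy` when `g x` is finite. -/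
noncomputable def realEnergy (p : InertialParams) (φ : RVec n → ℝ) (g : RVec n → EReal)
    (h : RVec n → ℝ) (x y : RVec n) : ℝ :=
  p.δ₁ * (φ x + (g x).toReal - h x) + 1 / 2 * ‖p.a • x + p.b • y‖ ^ 2

variable {p : InertialParams} {φ : RVec n → ℝ} {g : RVec n → EReal} {h : RVec n → ℝ}

lemma energy_eq_coe {z : RPair n} (hb : g z.fst ≠ ⊥) (ht : g z.fst ≠ ⊤) :
    energy p φ g h z = (realEnergy p φ g h z.fst z.snd : EReal) := by
  have e : g z.fst = ((g z.fst).toReal : EReal) := (EReal.coe_toReal ht hb).symm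
  unfold energy dcObjective realEnergy
  rw [e]
  norm_cast

lemma energy_eq_top (hδ : 0 < p.δ₁) {z : RPair n} (ht : g z.fst = ⊤) :
    energy p φ g h z = ⊤ := by
  unfold energy dcObjective
  rw [ht, EReal.coe_add_top, EReal.top_sub_coe, EReal.coe_mul_top_of_pos hδ, EReal.top_add_coe]

/-- Subgradients of the energy from convex subgradients `ξ` of `g`. The first-order errors of the
smooth functions `φ` and `h` are quadratic, so the sum rule needs no limiting argument. -/
lemma mem_frechetSubdiff_energy {L₁ L₃ : NNReal} (hφ : Differentiable ℝ φ) (hL₁ : 0 < L₁)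
    (hφL : LipschitzWith L₁ (gradient φ)) (hh : Differentiable ℝ h)
    (hhL : LipschitzWith L₃ (gradient h)) (hg : ∀ x, g x ≠ ⊥) (hδ : 0 < p.δ₁)
    {x y ξ : RVec n} (hx : g x ≠ ⊤)
    (hξ : ∀ w, g w ≠ ⊤ → (g x).toReal + inner ℝ ξ (w - x) ≤ (g w).toReal) :
    WithLp.toLp 2 (p.δ₁ • (gradient φ x - gradient h x + ξ) + p.a • (p.a • x + p.b • y),
      p.b • (p.a • x + p.b • y)) ∈ frechetSubdiff (energy p φ g h) (WithLp.toLp 2 (x, y)) := by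
  have hL : (0 : ℝ) < L₁ := hL₁
  have hL3 : (0 : ℝ) ≤ L₃ := L₃.2
  have hE : energy p φ g h (WithLp.toLp 2 (x, y)) = (realEnergy p φ g h x y : EReal) :=
    energy_eq_coe (z := WithLp.toLp 2 (x, y)) (hg x) hx
  refine mem_frechetSubdiff_of_quadratic (Q := p.δ₁ * ((L₁ + L₃) / 2)) ?_ (by positivity) ?_
  · rw [hE]
    exact EReal.coe_lt_top _
  intro w
  by_cases hw : g w.fst = ⊤
  · rw [energy_eq_top hδ hw]
    exact le_top
  rw [hE, energy_eq_coe (hg _) hw, ← EReal.coe_add, EReal.coe_le_coe_iff]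
  have h1 := (abs_le.1 (abs_sub_sub_inner_gradient_le hφ hφL x w.fst)).1
  have h2 := (abs_le.1 (abs_sub_sub_inner_gradient_le hh hhL x w.fst)).2
  have h3 := hξ w.fst hw
  have hn : ‖w - WithLp.toLp 2 (x, y)‖ ^ 2 = ‖w.fst - x‖ ^ 2 + ‖w.snd - y‖ ^ 2 := by
    rw [WithLp.prod_norm_sq_eq_of_L2]; rfl
  have h4 : 1 / 2 * ‖p.a • w.fst + p.b • w.snd‖ ^ 2 = 1 / 2 * ‖p.a • x + p.b • y‖ ^ 2
      + inner ℝ (p.a • x + p.b • y) (p.a • (w.fst - x) + p.b • (w.snd - y))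
      + 1 / 2 * ‖p.a • (w.fst - x) + p.b • (w.snd - y)‖ ^ 2 := by
    have e : p.a • w.fst + p.b • w.snd =
        (p.a • x + p.b • y) + (p.a • (w.fst - x) + p.b • (w.snd - y)) := by module
    rw [e, norm_add_sq_real]
    ring
  have hi : inner ℝ (WithLp.toLp 2 (p.δ₁ • (gradient φ x - gradient h x + ξ)
        + p.a • (p.a • x + p.b • y), p.b • (p.a • x + p.b • y))) (w - WithLp.toLp 2 (x, y)) =
      p.δ₁ * (inner ℝ (gradient φ x) (w.fst - x) - inner ℝ (gradient h x) (w.fst - x)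
        + inner ℝ ξ (w.fst - x))
      + inner ℝ (p.a • x + p.b • y) (p.a • (w.fst - x) + p.b • (w.snd - y)) := by
    rw [WithLp.prod_inner_apply]
    change inner ℝ (p.δ₁ • (gradient φ x - gradient h x + ξ) + p.a • (p.a • x + p.b • y))
      (w.fst - x) + inner ℝ (p.b • (p.a • x + p.b • y)) (w.snd - y) = _
    generalize p.a • x + p.b • y = q
    simp only [inner_add_left, inner_add_right, inner_sub_left, real_inner_smul_left,
      real_inner_smul_right]
    ring
  rw [hn, hi]
  unfold realEnergy
  rw [h4]
  have h5 : p.δ₁ * (φ x + (g x).toReal - h x + (inner ℝ (gradient φ x) (w.fst - x)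
      - inner ℝ (gradient h x) (w.fst - x) + inner ℝ ξ (w.fst - x))
      - (L₁ + L₃) / 2 * ‖w.fst - x‖ ^ 2) ≤ p.δ₁ * (φ w.fst + (g w.fst).toReal - h w.fst) := by
    refine mul_le_mul_of_nonneg_left ?_ hδ.le
    linarith
  have h6 : 0 ≤ p.δ₁ * ((L₁ + L₃) / 2) * ‖w.snd - y‖ ^ 2 := by positivity
  have h7 : 0 ≤ 1 / 2 * ‖p.a • (w.fst - x) + p.b • (w.snd - y)‖ ^ 2 := by positivity
  linarith

end Energy

/-! ### The inertial proximal method as a descent method -/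

section PairNorm

variable {n : ℕ}

lemma norm_sub_fst_le (u v u' v' : RVec n) :
    ‖u' - u‖ ≤ dist (WithLp.toLp 2 (u, v) : RPair n) (WithLp.toLp 2 (u', v')) := by
  rw [dist_comm, dist_eq_norm]
  have := WithLp.norm_fst_le _ (WithLp.toLp 2 (u', v') - WithLp.toLp 2 (u, v) : RPair n)
  rwa [WithLp.sub_fst] at this

lemma norm_sub_snd_le (u v u' v' : RVec n) :
    ‖v' - v‖ ≤ dist (WithLp.toLp 2 (u, v) : RPair n) (WithLp.toLp 2 (u', v')) := by
  rw [dist_comm, dist_eq_norm]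
  have := WithLp.norm_snd_le _ (WithLp.toLp 2 (u', v') - WithLp.toLp 2 (u, v) : RPair n)
  rwa [WithLp.sub_snd] at this

lemma norm_toLp_le (u v : RVec n) : ‖(WithLp.toLp 2 (u, v) : RPair n)‖ ≤ ‖u‖ + ‖v‖ := by
  refine le_of_sq_le_sq ?_ (by positivity)
  rw [WithLp.prod_norm_sq_eq_of_L2]
  change ‖u‖ ^ 2 + ‖v‖ ^ 2 ≤ _
  nlinarith [norm_nonneg u, norm_nonneg v]

end PairNorm

namespace IsInertialProxSeq

variable {n : ℕ} {p : InertialParams} {φ : RVec n → ℝ} {g : RVec n → EReal} {h : RVec n → ℝ}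
  {L₁ L₃ : NNReal} {x y : ℕ → RVec n}

lemma ne_top (hxy : IsInertialProxSeq p φ g h x y) (hg : IsProperFun g) (k : ℕ) :
    g (x (k + 1)) ≠ ⊤ := by
  obtain ⟨w, hw⟩ := hg.2
  intro htop
  have h1 := hxy.prox_step k w
  unfold proxObjective at h1
  rw [htop, EReal.top_add_coe, top_le_iff] at h1
  exact EReal.add_ne_top hw.ne (EReal.coe_ne_top _) h1

/-- The inertial combination in terms of the two increments. -/
lemma inertial_eq (hxy : IsInertialProxSeq p φ g h x y) (hρ : p.ρ ≠ 0) (k : ℕ) :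
    p.α • x k + p.β • y k =
      -(p.ρ • (y (k + 1) - y k)) - (p.γ * p.α) • (x (k + 1) - x k) := by
  rw [hxy.inertial_step k, sub_sub_cancel_left, smul_neg, neg_neg, smul_smul,
    mul_one_div_cancel hρ, one_smul]
  abel

/-- The convex subgradient of `g` at `x (k + 1)` given by the optimality condition of the proximal
step. -/
noncomputable def proxSubgradient (p : InertialParams) (φ h : RVec n → ℝ) (x y : ℕ → RVec n)
    (k : ℕ) : RVec n :=
  gradient h (x k) - gradient φ (x k) - (p.mu / p.lam) • (p.α • x k + p.β • y k)
    - (1 / p.lam) • (x (k + 1) - x k)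

lemma proxSubgradient_le (hxy : IsInertialProxSeq p φ g h x y) (hg : IsProperFun g)
    (hgc : IsConvexFun g) (k : ℕ) {w : RVec n} (hw : g w ≠ ⊤) :
    (g (x (k + 1))).toReal + inner ℝ (proxSubgradient p φ h x y k) (w - x (k + 1)) ≤
      (g w).toReal := by
  refine subgradient_of_prox_minimizer hg.1 hgc (hxy.ne_top hg k) (fun w => ?_) hw
  have h1 := hxy.prox_step k w
  unfold proxObjective at h1
  have e : ∀ v : RVec n, -inner ℝ (gradient h (x k) - gradient φ (x k)
        - (p.mu / p.lam) • (p.α • x k + p.β • y k)) (v - x k) =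
      -inner ℝ (gradient h (x k) - gradient φ (x k)) (v - x k)
        + p.mu / p.lam * inner ℝ (p.α • x k + p.β • y k) (v - x k) := by
    intro v
    rw [inner_sub_left _ ((p.mu / p.lam) • _), real_inner_smul_left]
    ring
  rw [e, e]
  exact h1

/-- Decrease of the energy in one step. Beyond the asserted decrease there is a term
`e ‖x (k + 1) - x k‖ ^ 2` with `e > 0`, because the descent inequality only costs `L₁ / 2`. -/
lemma realEnergy_succ_le (hxy : IsInertialProxSeq p φ g h x y) (hφ : Differentiable ℝ φ)
    (hφL : LipschitzWith L₁ (gradient φ)) (hg : IsProperFun g) (hgc : IsConvexFun g)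
    (hhc : ConvexOn ℝ univ h) (hh : Differentiable ℝ h) (hlam : 0 < p.lam) (hmu : 0 < p.mu)
    (hs : 0 < 2 + p.α + p.β) (hρ : 0 < p.ρ) (hγ : 1 / 2 ≤ p.γ)
    (hstep : p.lam * L₁ + p.mu * (p.γ * p.α + p.ρ) ≤ 1) (hδ : 0 < p.a₂ + p.b₂) (k : ℕ)
    (hk : g (x k) ≠ ⊤) :
    realEnergy p φ g h (x (k + 1)) (y (k + 1)) ≤ realEnergy p φ g h (x k) (y k) -
      (1 / 2 * (2 * p.a₂ + p.b₂) * ‖x (k + 1) - x k‖ ^ 2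
        + p.b₂ / 2 * ‖y (k + 1) - y k‖ ^ 2
        + p.b₂ / 2 * ‖(x (k + 1) - x k) - (y (k + 1) - y k)‖ ^ 2
        + p.δ₁ * (L₁ / 2) * ‖x (k + 1) - x k‖ ^ 2) := by
  have hδ₁ : 0 < p.δ₁ := mul_pos hδ (div_pos hlam (mul_pos hρ hmu))
  have h1 := (abs_le.1 (abs_sub_sub_inner_gradient_le hφ hφL (x k) (x (k + 1)))).2
  have h2 := hhc.add_inner_gradient_le hh (x k) (x (k + 1))
  have h3 := hxy.proxSubgradient_le hg hgc k hk
  have hu := hxy.inertial_eq hρ.ne' k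
  have h4 := InertialParams.half_norm_sq_step hs hu
  have e1 : x k - x (k + 1) = -(x (k + 1) - x k) := by abel
  unfold proxSubgradient at h3
  rw [hu, e1] at h3
  unfold realEnergy
  rw [h4]
  generalize x (k + 1) - x k = X at *
  generalize y (k + 1) - y k = Y at *
  rw [norm_sub_sq_real]
  simp only [inner_neg_right, inner_sub_left, inner_neg_left, real_inner_smul_left,
    real_inner_self_eq_norm_sq, real_inner_comm X Y] at h3
  -- The decrease of the objective, scaled so that its inner product has coefficient `a₂ + b₂`.
  have h5 : φ (x (k + 1)) + (g (x (k + 1))).toReal - h (x (k + 1)) ≤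
      φ (x k) + (g (x k)).toReal - h (x k) + (p.mu * p.ρ / p.lam) * inner ℝ X Y
        - (1 / p.lam - L₁ / 2 - p.mu * (p.γ * p.α) / p.lam) * ‖X‖ ^ 2 := by
    have e2 : p.mu / p.lam * (-(p.ρ * inner ℝ X Y) - p.γ * p.α * ‖X‖ ^ 2) =
      -((p.mu * p.ρ / p.lam) * inner ℝ X Y) - p.mu * (p.γ * p.α) / p.lam * ‖X‖ ^ 2 := by ring
    linarith
  have h6 : p.mu * p.ρ / p.lam + L₁ / 2 ≤
      1 / p.lam - L₁ / 2 - p.mu * (p.γ * p.α) / p.lam := by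
    have e3 : 1 / p.lam - L₁ / 2 - p.mu * (p.γ * p.α) / p.lam - (p.mu * p.ρ / p.lam + L₁ / 2) =
        (1 - (p.lam * L₁ + p.mu * (p.γ * p.α + p.ρ))) / p.lam := by
      field_simp
      ring
    have : 0 ≤ (1 - (p.lam * L₁ + p.mu * (p.γ * p.α + p.ρ))) / p.lam :=
      div_nonneg (by linarith) hlam.le
    linarith
  have h7 := mul_le_mul_of_nonneg_right h6 (sq_nonneg ‖X‖)
  have h8 : φ (x (k + 1)) + (g (x (k + 1))).toReal - h (x (k + 1)) ≤
      φ (x k) + (g (x k)).toReal - h (x k) + (p.mu * p.ρ / p.lam) * inner ℝ X Y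
        - (p.mu * p.ρ / p.lam + L₁ / 2) * ‖X‖ ^ 2 := by linarith
  have h9 := mul_le_mul_of_nonneg_left h8 hδ₁.le
  have e4 : p.δ₁ * (p.mu * p.ρ / p.lam) = p.a₂ + p.b₂ := by
    unfold InertialParams.δ₁
    field_simp
  have e5 : p.δ₁ * (φ (x k) + (g (x k)).toReal - h (x k) + (p.mu * p.ρ / p.lam) * inner ℝ X Y
        - (p.mu * p.ρ / p.lam + L₁ / 2) * ‖X‖ ^ 2) =
      p.δ₁ * (φ (x k) + (g (x k)).toReal - h (x k)) +
        p.δ₁ * (p.mu * p.ρ / p.lam) * inner ℝ X Y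
        - (p.δ₁ * (p.mu * p.ρ / p.lam) + p.δ₁ * (L₁ / 2)) * ‖X‖ ^ 2 := by ring
  rw [e5, e4] at h9
  have h10 : 0 ≤ p.a ^ 2 * (p.γ - 1 / 2) * ‖X‖ ^ 2 :=
    mul_nonneg (mul_nonneg (sq_nonneg _) (by linarith)) (sq_nonneg _)
  linarith

/-- Passage from the real to the extended-real form of the decrease. At the starting point the
energy may be infinite. -/
lemma energy_succ_le (hxy : IsInertialProxSeq p φ g h x y) (hg : IsProperFun g)
    (hδ₁ : 0 < p.δ₁) (k : ℕ) {r : ℝ}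
    (hr : g (x k) ≠ ⊤ → realEnergy p φ g h (x (k + 1)) (y (k + 1)) ≤
      realEnergy p φ g h (x k) (y k) - r) :
    energy p φ g h (WithLp.toLp 2 (x (k + 1), y (k + 1))) ≤
      energy p φ g h (WithLp.toLp 2 (x k, y k)) - (r : EReal) := by
  by_cases hk : g (x k) = ⊤
  · rw [energy_eq_top (z := WithLp.toLp 2 (x k, y k)) hδ₁ hk, EReal.top_sub_coe]
    exact le_top
  · rw [energy_eq_coe (z := WithLp.toLp 2 (x k, y k)) (hg.1 _) hk,
      energy_eq_coe (z := WithLp.toLp 2 (x (k + 1), y (k + 1))) (hg.1 _) (hxy.ne_top hg k)]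
    exact_mod_cast hr hk

/-- The subgradient of the energy at the iterate `k + 1` built from `proxSubgradient`. -/
noncomputable def energySubgradient (p : InertialParams) (φ h : RVec n → ℝ) (x y : ℕ → RVec n)
    (k : ℕ) : RPair n :=
  WithLp.toLp 2 (p.δ₁ • (gradient φ (x (k + 1)) - gradient h (x (k + 1))
      + proxSubgradient p φ h x y k) + p.a • (p.a • x (k + 1) + p.b • y (k + 1)),
    p.b • (p.a • x (k + 1) + p.b • y (k + 1)))

lemma energySubgradient_mem (hxy : IsInertialProxSeq p φ g h x y) (hφ : Differentiable ℝ φ)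
    (hL₁ : 0 < L₁) (hφL : LipschitzWith L₁ (gradient φ)) (hg : IsProperFun g)
    (hgc : IsConvexFun g) (hh : Differentiable ℝ h) (hhL : LipschitzWith L₃ (gradient h))
    (hδ₁ : 0 < p.δ₁) (k : ℕ) :
    energySubgradient p φ h x y k ∈
      frechetSubdiff (energy p φ g h) (WithLp.toLp 2 (x (k + 1), y (k + 1))) :=
  mem_frechetSubdiff_energy hφ hL₁ hφL hh hhL hg.1 hδ₁ (hxy.ne_top hg k)
    fun _ hw => hxy.proxSubgradient_le hg hgc k hw

/-- The subgradients of the energy along the iterates are bounded by the step lengths. -/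
lemma exists_norm_energySubgradient_le (hxy : IsInertialProxSeq p φ g h x y)
    (hφL : LipschitzWith L₁ (gradient φ)) (hhL : LipschitzWith L₃ (gradient h))
    (hρ : p.ρ ≠ 0) :
    ∃ C : ℝ, 0 < C ∧ ∀ k, ‖energySubgradient p φ h x y k‖ ≤
      C * dist (WithLp.toLp 2 (x k, y k) : RPair n) (WithLp.toLp 2 (x (k + 1), y (k + 1))) := by
  set s := |2 / (2 + p.α + p.β)|
  set R := |p.ρ| + |p.γ * p.α|
  refine ⟨|p.δ₁| * (L₁ + L₃ + |p.mu / p.lam| * R + |1 / p.lam|)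
    + (|p.a| + |p.b|) * (s * (R + |p.α| + |p.β|)) + 1, by positivity, fun k => ?_⟩
  set d := dist (WithLp.toLp 2 (x k, y k) : RPair n) (WithLp.toLp 2 (x (k + 1), y (k + 1)))
  have hd0 : 0 ≤ d := dist_nonneg
  have hX : ‖x (k + 1) - x k‖ ≤ d := norm_sub_fst_le _ _ _ _
  have hY : ‖y (k + 1) - y k‖ ≤ d := norm_sub_snd_le _ _ _ _
  have hu : ‖p.α • x k + p.β • y k‖ ≤ R * d := by
    rw [hxy.inertial_eq hρ k]
    refine (norm_sub_le _ _).trans ?_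
    rw [norm_neg, norm_smul, norm_smul, Real.norm_eq_abs, Real.norm_eq_abs, add_mul]
    gcongr
  have hu' : ‖p.a • x (k + 1) + p.b • y (k + 1)‖ ≤ s * (R + |p.α| + |p.β|) * d := by
    rw [InertialParams.a_smul_add_b_smul, norm_smul, Real.norm_eq_abs, mul_assoc]
    refine mul_le_mul_of_nonneg_left ?_ (abs_nonneg _)
    have e : p.α • x (k + 1) + p.β • y (k + 1) =
        (p.α • x k + p.β • y k) + p.α • (x (k + 1) - x k) + p.β • (y (k + 1) - y k) := by module
    rw [e, add_mul, add_mul]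
    refine (norm_add₃_le).trans ?_
    rw [norm_smul, norm_smul, Real.norm_eq_abs, Real.norm_eq_abs]
    gcongr
  have hφd : ‖gradient φ (x (k + 1)) - gradient φ (x k)‖ ≤ L₁ * d := by
    rw [← dist_eq_norm]
    refine (hφL.dist_le_mul _ _).trans ?_
    rw [dist_eq_norm]
    gcongr
  have hhd : ‖gradient h (x (k + 1)) - gradient h (x k)‖ ≤ L₃ * d := by
    rw [← dist_eq_norm]
    refine (hhL.dist_le_mul _ _).trans ?_
    rw [dist_eq_norm]
    gcongr
  have hv : ‖gradient φ (x (k + 1)) - gradient h (x (k + 1)) + proxSubgradient p φ h x y k‖ ≤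
      (L₁ + L₃ + |p.mu / p.lam| * R + |1 / p.lam|) * d := by
    have e : gradient φ (x (k + 1)) - gradient h (x (k + 1)) + proxSubgradient p φ h x y k =
        (gradient φ (x (k + 1)) - gradient φ (x k))
        - (gradient h (x (k + 1)) - gradient h (x k))
        - (p.mu / p.lam) • (p.α • x k + p.β • y k) - (1 / p.lam) • (x (k + 1) - x k) := by
      unfold proxSubgradient
      abel
    rw [e]
    have t1 : ‖(p.mu / p.lam) • (p.α • x k + p.β • y k)‖ ≤ |p.mu / p.lam| * (R * d) := by
      rw [norm_smul, Real.norm_eq_abs]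
      gcongr
    have t2 : ‖(1 / p.lam) • (x (k + 1) - x k)‖ ≤ |1 / p.lam| * d := by
      rw [norm_smul, Real.norm_eq_abs]
      gcongr
    refine (norm_sub_le_of_le (norm_sub_le_of_le (norm_sub_le_of_le hφd hhd) t1) t2).trans_eq ?_
    ring
  unfold energySubgradient
  refine (norm_toLp_le _ _).trans ((add_le_add_left (norm_add_le _ _) _).trans ?_)
  rw [norm_smul, norm_smul, norm_smul, Real.norm_eq_abs, Real.norm_eq_abs, Real.norm_eq_abs]
  have t1 := mul_le_mul_of_nonneg_left hv (abs_nonneg p.δ₁)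
  have t2 := mul_le_mul_of_nonneg_left hu' (abs_nonneg p.a)
  have t3 := mul_le_mul_of_nonneg_left hu' (abs_nonneg p.b)
  calc _ ≤ _ := add_le_add (add_le_add t1 t2) t3
    _ ≤ _ + d := le_add_of_nonneg_right hd0
    _ = _ := by ring

end IsInertialProxSeq

/-! ### Limits of the energy at cluster points -/

section LowerSemicontinuous

lemma LowerSemicontinuous.exists_eventually_le_toReal {X : Type*} [TopologicalSpace X]
    {g : X → EReal} {xs : ℕ → X} {xlim : X} (hg : LowerSemicontinuous g)
    (hb : g xlim ≠ ⊥) (hx : Tendsto xs atTop (𝓝 xlim)) (hfin : ∀ j, g (xs j) ≠ ⊤) :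
    ∃ r : ℝ, ∀ᶠ j in atTop, r ≤ (g (xs j)).toReal := by
  obtain ⟨r, -, hr⟩ := EReal.lt_iff_exists_real_btwn.1 (bot_lt_iff_ne_bot.2 hb)
  refine ⟨r, (hx.eventually (hg xlim r hr)).mono fun j hj => ?_⟩
  rw [← EReal.coe_le_coe_iff, EReal.coe_toReal (hfin j) (bot_le.trans_lt hj).ne']
  exact hj.le

/-- Along a convergent sequence with convergent convex subgradients and bounded values, a lower
semicontinuous function converges to its value at the limit: lower semicontinuity bounds the limit
from below, the subgradient inequality evaluated at the limit point bounds it from above. -/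
lemma LowerSemicontinuous.tendsto_toReal_of_subgradient {E : Type*} [NormedAddCommGroup E]
    [InnerProductSpace ℝ E] {g : E → EReal} {xs : ℕ → E} {xlim : E} (hg : LowerSemicontinuous g)
    (hb : ∀ x, g x ≠ ⊥) (hx : Tendsto xs atTop (𝓝 xlim)) (hfin : ∀ j, g (xs j) ≠ ⊤) {R : ℝ}
    (hR : ∀ᶠ j in atTop, (g (xs j)).toReal ≤ R) {ξs : ℕ → E} {ξ : E}
    (hξ : Tendsto ξs atTop (𝓝 ξ))
    (hsub : ∀ j, g xlim ≠ ⊤ →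
      (g (xs j)).toReal + inner ℝ (ξs j) (xlim - xs j) ≤ (g xlim).toReal) :
    g xlim ≠ ⊤ ∧ Tendsto (fun j => (g (xs j)).toReal) atTop (𝓝 (g xlim).toReal) := by
  have hlow : ∀ r : ℝ, (r : EReal) < g xlim → ∀ᶠ j in atTop, r < (g (xs j)).toReal := by
    intro r hr
    refine (hx.eventually (hg xlim r hr)).mono fun j hj => ?_
    rwa [← EReal.coe_lt_coe_iff, EReal.coe_toReal (hfin j) (hb _)]
  have htop : g xlim ≠ ⊤ := by
    intro h
    obtain ⟨j, hj, hj'⟩ := ((hlow R (by rw [h]; exact EReal.coe_lt_top R)).and hR).exists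
    linarith
  refine ⟨htop, tendsto_order.2 ⟨fun r hr => hlow r ?_, fun r hr => ?_⟩⟩
  · rwa [← EReal.coe_toReal htop (hb _), EReal.coe_lt_coe_iff]
  · have h1 : Tendsto (fun j => (g xlim).toReal - inner ℝ (ξs j) (xlim - xs j)) atTop
        (𝓝 (g xlim).toReal) := by
      simpa using (tendsto_const_nhds (x := (g xlim).toReal)).sub
        (hξ.inner (𝕜 := ℝ) ((tendsto_const_nhds (x := xlim)).sub hx))
    filter_upwards [h1.eventually_lt_const hr] with j hj
    linarith [hsub j htop]

end LowerSemicontinuous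

namespace IsInertialProxSeq

variable {n : ℕ} {p : InertialParams} {φ : RVec n → ℝ} {g : RVec n → EReal} {h : RVec n → ℝ}
  {L₁ L₃ : NNReal} {x y : ℕ → RVec n}

/-- At a cluster point of `x`, the iterates from index one on form a descent sequence for the
energy, and the subgradients of the energy along the iterates accumulate at zero. The starting
point is left out because its energy may be infinite. -/
theorem exists_isDescentSeq (hxy : IsInertialProxSeq p φ g h x y) (hφ : Differentiable ℝ φ)
    (hL₁ : 0 < L₁) (hφL : LipschitzWith L₁ (gradient φ)) (hg : IsProperFun g)
    (hglsc : LowerSemicontinuous g) (hgc : IsConvexFun g)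
    (hhc : ConvexOn ℝ univ h) (hh : Differentiable ℝ h) (hhL : LipschitzWith L₃ (gradient h))
    (hlam : 0 < p.lam) (hmu : 0 < p.mu) (hβ : 0 < p.β)
    (hαβ : 0 < p.α + p.β) (hτ : -(2 + p.α) / (2 * p.β) < p.τ) (hγ : 1 / 2 ≤ p.γ)
    (hstep : p.lam * L₁ + p.mu * (p.γ * p.α + p.ρ) ≤ 1) (hδ : 0 < p.a₂ + p.b₂)
    (h43 : 0 ≤ 4 * p.a₂ + 3 * p.b₂) {xlim : RVec n} (hlim : MapClusterPt xlim atTop x) :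
    ∃ (Fs : ℝ) (t : ℕ → ℝ) (c C : ℝ),
      IsDescentSeq (energy p φ g h) (fun k => WithLp.toLp 2 (x (k + 1), y (k + 1)))
        (WithLp.toLp 2 (xlim, -(p.α / p.β) • xlim)) Fs t c C ∧
      0 ∈ limitingSubdiff (energy p φ g h) (WithLp.toLp 2 (xlim, -(p.α / p.β) • xlim)) := by
  have hρ := InertialParams.ρ_pos hβ hτ
  have hδ₁ := InertialParams.δ₁_pos hβ hτ hlam hmu hδ
  have hL : (0 : ℝ) < L₁ := hL₁
  obtain ⟨c, hc, hcoer⟩ := InertialParams.exists_coercive (E := RVec n)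
    (InertialParams.b₂_pos hβ hαβ hτ) (show 0 < p.δ₁ * (L₁ / 2) by positivity) h43
  obtain ⟨C, hC, hCv⟩ := hxy.exists_norm_energySubgradient_le hφL hhL hρ.ne'
  set z : ℕ → RPair n := fun k => WithLp.toLp 2 (x (k + 1), y (k + 1)) with hz
  set ylim : RVec n := -(p.α / p.β) • xlim with hylim
  set V : ℕ → ℝ := fun k => realEnergy p φ g h (x (k + 1)) (y (k + 1)) with hV
  have hfin : ∀ k, g (x (k + 1)) ≠ ⊤ := hxy.ne_top hg
  have hdec : ∀ k, c * dist (z k) (z (k + 1)) ^ 2 ≤ V k - V (k + 1) := by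
    intro k
    have h1 := hxy.realEnergy_succ_le hφ hφL hg hgc hhc hh hlam hmu (by linarith) hρ hγ hstep hδ
      (k + 1) (hfin k)
    have h2 := hcoer (x (k + 1 + 1) - x (k + 1)) (y (k + 1 + 1) - y (k + 1))
    have h3 : dist (z k) (z (k + 1)) ^ 2 =
        ‖x (k + 1 + 1) - x (k + 1)‖ ^ 2 + ‖y (k + 1 + 1) - y (k + 1)‖ ^ 2 := by
      rw [dist_comm, dist_eq_norm, WithLp.prod_norm_sq_eq_of_L2]
      rfl
    rw [h3]
    simp only [hV]
    linarith
  have hanti : Antitone V := antitone_nat_of_succ_le fun k => by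
    have := hdec k
    have : 0 ≤ c * dist (z k) (z (k + 1)) ^ 2 := by positivity
    linarith
  -- `σ` enumerates indices along which the shifted sequence converges to the cluster point.
  obtain ⟨ψ, hψ, hψlim⟩ := hlim.tendsto_subseq
  set σ : ℕ → ℕ := fun j => ψ (j + 1) - 1
  have hσ1 : ∀ j, σ j + 1 = ψ (j + 1) := fun j => by
    have : j + 1 ≤ ψ (j + 1) := hψ.id_le (j + 1)
    change ψ (j + 1) - 1 + 1 = _
    omega
  have hσ : Tendsto σ atTop atTop := tendsto_atTop_mono (fun j => by
    have h1 : j + 1 ≤ ψ (j + 1) := hψ.id_le (j + 1)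
    have := hσ1 j
    show j ≤ σ j
    omega) tendsto_id
  have hx1 : Tendsto (fun j => x (σ j + 1)) atTop (𝓝 xlim) := by
    simp_rw [hσ1]
    exact (tendsto_add_atTop_iff_nat 1).2 hψlim
  have hφh : Continuous fun w => φ w - h w := hφ.continuous.sub hh.continuous
  -- The energy is bounded below along the subsequence, so it converges.
  obtain ⟨ℓ, hℓ⟩ : ∃ ℓ, Tendsto V atTop (𝓝 ℓ) := by
    refine (tendsto_atTop_of_antitone hanti).resolve_left fun hbot => ?_
    obtain ⟨r, hr⟩ := hglsc.exists_eventually_le_toReal (hg.1 xlim) hx1 fun j => hfin (σ j)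
    have h1 := ((hφh.tendsto xlim).comp hx1).eventually_const_lt (sub_one_lt _)
    obtain ⟨j, hj1, hj2, hj3⟩ := (hr.and (h1.and ((hbot.comp hσ).eventually
      (eventually_lt_atBot (p.δ₁ * (φ xlim - h xlim - 1 + r)))))).exists
    simp only [Function.comp_apply] at hj2 hj3
    have h2 : p.δ₁ * (φ xlim - h xlim - 1 + r) ≤
        p.δ₁ * (φ (x (σ j + 1)) + (g (x (σ j + 1))).toReal - h (x (σ j + 1))) :=
      mul_le_mul_of_nonneg_left (by linarith) hδ₁.le
    have h3 : 0 ≤ 1 / 2 * ‖p.a • x (σ j + 1) + p.b • y (σ j + 1)‖ ^ 2 := by positivity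
    simp only [hV, realEnergy] at hj3
    linarith
  set t : ℕ → ℝ := fun k => V k - ℓ with ht
  have htdec : ∀ k, c * dist (z k) (z (k + 1)) ^ 2 ≤ t k - t (k + 1) := fun k => by
    have := hdec k
    simp only [ht]
    linarith
  have ht0 : Tendsto t atTop (𝓝 0) := by simpa using hℓ.sub_const ℓ
  have hd0 := tendsto_dist_succ_of_decrease hc htdec ht0
  have hdx : Tendsto (fun j => x (σ j + 2) - x (σ j + 1)) atTop (𝓝 0) :=
    squeeze_zero_norm (fun j => norm_sub_fst_le _ (y (σ j + 1)) _ (y (σ j + 2))) (hd0.comp hσ)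
  have hdy : Tendsto (fun j => y (σ j + 2) - y (σ j + 1)) atTop (𝓝 0) :=
    squeeze_zero_norm (fun j => norm_sub_snd_le (x (σ j + 1)) _ (x (σ j + 2)) _) (hd0.comp hσ)
  have hx2 : Tendsto (fun j => x (σ j + 2)) atTop (𝓝 xlim) := by
    simpa using hx1.add hdx
  have hu : Tendsto (fun j => p.α • x (σ j + 1) + p.β • y (σ j + 1)) atTop (𝓝 0) := by
    have h1 : Tendsto (fun j => -(p.ρ • (y (σ j + 2) - y (σ j + 1)))
        - (p.γ * p.α) • (x (σ j + 2) - x (σ j + 1))) atTop (𝓝 0) := by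
      simpa using (hdy.const_smul p.ρ).neg.sub (hdx.const_smul (p.γ * p.α))
    exact h1.congr fun j => (hxy.inertial_eq hρ.ne' (σ j + 1)).symm
  have hy1 : Tendsto (fun j => y (σ j + 1)) atTop (𝓝 ylim) := by
    have h1 := ((hu.sub (hx1.const_smul p.α)).const_smul (1 / p.β))
    have e : (1 / p.β) • (0 - p.α • xlim) = ylim := by
      rw [hylim, zero_sub, smul_neg, smul_smul, neg_smul, one_div_mul_eq_div]
    rw [e] at h1
    refine h1.congr fun j => ?_
    rw [add_sub_cancel_left, smul_smul, one_div_mul_cancel hβ.ne', one_smul]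
  have hy2 : Tendsto (fun j => y (σ j + 2)) atTop (𝓝 ylim) := by
    simpa using hy1.add hdy
  have hξ : Tendsto (fun j => proxSubgradient p φ h x y (σ j + 1)) atTop
      (𝓝 (gradient h xlim - gradient φ xlim)) := by
    have h1 := (((hhL.continuous.tendsto xlim).comp hx1).sub
      ((hφL.continuous.tendsto xlim).comp hx1)).sub (hu.const_smul (p.mu / p.lam)) |>.sub
      (hdx.const_smul (1 / p.lam))
    rw [smul_zero, smul_zero, sub_zero, sub_zero] at h1
    exact h1
  have hbound : ∀ᶠ j in atTop, (g (x (σ j + 2))).toReal ≤ V 0 / p.δ₁ - (φ xlim - h xlim - 1) := by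
    filter_upwards [((hφh.tendsto xlim).comp hx2).eventually_const_lt (sub_one_lt _)] with j hj
    have h1 : V (σ j + 1) ≤ V 0 := hanti (Nat.zero_le _)
    have h2 : p.δ₁ * (φ (x (σ j + 2)) + (g (x (σ j + 2))).toReal - h (x (σ j + 2))) ≤ V 0 := by
      refine le_trans ?_ h1
      exact le_add_of_nonneg_right (by positivity)
    rw [← le_div_iff₀' hδ₁] at h2
    simp only [Function.comp_apply] at hj
    linarith
  obtain ⟨hgtop, hglim⟩ := hglsc.tendsto_toReal_of_subgradient hg.1 hx2 (fun j => hfin (σ j + 1))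
    hbound hξ fun j hw => hxy.proxSubgradient_le hg hgc (σ j + 1) hw
  have hVlim : Tendsto (fun j => V (σ j + 1)) atTop (𝓝 (realEnergy p φ g h xlim ylim)) :=
    (((((hφ.continuous.tendsto xlim).comp hx2).add hglim).sub
      ((hh.continuous.tendsto xlim).comp hx2)).const_mul p.δ₁).add
      ((((hx2.const_smul p.a).add (hy2.const_smul p.b)).norm.pow 2).const_mul (1 / 2))
  have hℓ1 : Tendsto (fun j => V (σ j + 1)) atTop (𝓝 ℓ) :=
    ((tendsto_add_atTop_iff_nat 1).2 hℓ).comp hσ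
  have hℓeq : realEnergy p φ g h xlim ylim = ℓ := tendsto_nhds_unique hVlim hℓ1
  have hzlim : Tendsto (fun j => z (σ j + 1)) atTop (𝓝 (WithLp.toLp 2 (xlim, ylim))) :=
    ((WithLp.prod_continuous_toLp 2 (RVec n) (RVec n)).tendsto (xlim, ylim)).comp
      (hx2.prodMk_nhds hy2)
  have hFs : energy p φ g h (WithLp.toLp 2 (xlim, ylim)) = (ℓ : EReal) := by
    rw [← hℓeq]
    exact energy_eq_coe (z := WithLp.toLp 2 (xlim, ylim)) (hg.1 _) hgtop
  have hval : ∀ k, energy p φ g h (z k) = (V k : EReal) := fun k =>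
    energy_eq_coe (z := z k) (hg.1 _) (hfin k)
  have hmem : ∀ k, energySubgradient p φ h x y (k + 1) ∈ frechetSubdiff (energy p φ g h)
      (z (k + 1)) := fun k =>
    hxy.energySubgradient_mem hφ hL₁ hφL hg hgc hh hhL hδ₁ (k + 1)
  refine ⟨ℓ, t, c, C, ⟨hc, hC, ?_, hFs, ?_, htdec, ?_, ht0, ?_⟩, ?_⟩
  · exact MapClusterPt.of_comp ((tendsto_add_atTop_nat 1).comp hσ) hzlim.mapClusterPt
  · intro k
    rw [hval, ht, add_sub_cancel]
  · exact fun k => sub_nonneg.2 (hanti.le_of_tendsto hℓ k)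
  · exact fun k => ⟨_, frechetSubdiff_subset_limitingSubdiff _ _ (hmem k), hCv (k + 1)⟩
  · refine ⟨by rw [hFs]; exact EReal.coe_lt_top ℓ, fun j => z (σ j + 1),
      fun j => energySubgradient p φ h x y (σ j + 1), hzlim, ?_, fun j => hmem (σ j), ?_⟩
    · rw [hFs]
      simp_rw [hval]
      exact (continuous_coe_real_ereal.tendsto ℓ).comp hℓ1
    · refine squeeze_zero_norm (fun j => hCv (σ j + 1)) ?_
      simpa using (hd0.comp hσ).const_mul C

end IsInertialProxSeq

/-! ### Convergence and rates -/

theorem mainTheorem3 (n : ℕ) (p : InertialParams)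
    (φ : RVec n → ℝ) (g : RVec n → EReal) (h : RVec n → ℝ) (L₁ L₃ : NNReal)
    (hφ : Differentiable ℝ φ) (hL₁ : 0 < L₁) (hφL : LipschitzWith L₁ (gradient φ))
    (hg_proper : IsProperFun g) (hg_lsc : LowerSemicontinuous g) (hg_conv : IsConvexFun g)
    (hh_conv : ConvexOn ℝ Set.univ h) (hh : Differentiable ℝ h)
    (hhL : LipschitzWith L₃ (gradient h))
    (hlam : 0 < p.lam) (hmu : 0 < p.mu) (hβ : 0 < p.β) (hαβ : 0 < p.α + p.β)
    (hτ : -(2 + p.α) / (2 * p.β) < p.τ) (hγ : 1 / 2 ≤ p.γ)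
    (hstep : p.lam * L₁ + p.mu * (p.γ * p.α + p.ρ) ≤ 1)
    (hδ₁ : 0 < p.a₂ + p.b₂)
    (hKL : IsKLFunction (energy p φ g h))
    (x y : ℕ → RVec n) (hxy : IsInertialProxSeq p φ g h x y) :
    -- sufficient decrease
    (∀ k : ℕ, energy p φ g h (WithLp.toLp 2 (x (k + 1), y (k + 1))) ≤
      energy p φ g h (WithLp.toLp 2 (x k, y k)) -
        ((1 / 2 * (2 * p.a₂ + p.b₂) * ‖x (k + 1) - x k‖ ^ 2
          + p.b₂ / 2 * ‖y (k + 1) - y k‖ ^ 2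
          + p.b₂ / 2 * ‖(x (k + 1) - x k) - (y (k + 1) - y k)‖ ^ 2 : ℝ) : EReal)) ∧
    -- convergence and rates
    (0 ≤ 4 * p.a₂ + 3 * p.b₂ → ∀ xlim : RVec n, MapClusterPt xlim atTop x →
      Tendsto x atTop (𝓝 xlim) ∧
      ∀ M κ : ℝ, 0 < M → 0 ≤ κ → κ < 1 →
        KLInequalityAt (energy p φ g h) (WithLp.toLp 2 (xlim, -(p.α / p.β) • xlim))
          (fun t : ℝ => M * t ^ (1 - κ)) →
        (κ = 0 → ∃ K : ℕ, ∀ k ≥ K, x k = xlim ∧ y k = -(p.α / p.β) • xlim) ∧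
        (0 < κ → κ ≤ 1 / 2 → ∃ A₁ : ℝ, 0 < A₁ ∧ ∃ ζ : ℝ, 0 < ζ ∧ ζ < 1 ∧
          ∀ k : ℕ, ‖x k - xlim‖ ≤ A₁ * ζ ^ k) ∧
        (1 / 2 < κ → ∃ A₂ : ℝ, 0 < A₂ ∧
          ∀ k : ℕ, 1 ≤ k → ‖x k - xlim‖ ≤ A₂ * (k : ℝ) ^ ((1 - κ) / (1 - 2 * κ)))) := by
  have hρ := InertialParams.ρ_pos hβ hτ
  have hδp := InertialParams.δ₁_pos hβ hτ hlam hmu hδ₁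
  refine ⟨fun k => hxy.energy_succ_le hg_proper hδp k fun hk => ?_, fun h43 xlim hlim => ?_⟩
  · have h1 := hxy.realEnergy_succ_le hφ hφL hg_proper hg_conv hh_conv hh hlam hmu (by linarith)
      hρ hγ hstep hδ₁ k hk
    have h2 : 0 ≤ p.δ₁ * (L₁ / 2) * ‖x (k + 1) - x k‖ ^ 2 := by positivity
    linarith
  obtain ⟨Fs, t, c, C, hs, h0⟩ := hxy.exists_isDescentSeq hφ hL₁ hφL hg_proper hg_lsc hg_conv
    hh_conv hh hhL hlam hmu hβ hαβ hτ hγ hstep hδ₁ h43 hlim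
  have hdist : ∀ k, ‖x (k + 1) - xlim‖ ≤ dist (WithLp.toLp 2 (x (k + 1), y (k + 1)) : RPair n)
      (WithLp.toLp 2 (xlim, -(p.α / p.β) • xlim)) := fun k => by
    rw [dist_comm]
    exact norm_sub_fst_le _ _ _ _
  refine ⟨?_, fun M κ hM hκ0 hκ1 hKLz => ⟨fun hκ => ?_, fun hκ hκ2 => ?_, fun hκ => ?_⟩⟩
  · obtain ⟨θ, hθ⟩ := hKL _ ⟨0, h0⟩
    rw [← tendsto_add_atTop_iff_nat 1, tendsto_iff_norm_sub_tendsto_zero]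
    exact squeeze_zero (fun _ => norm_nonneg _) hdist
      (tendsto_iff_dist_tendsto_zero.1 (hs.tendsto hθ))
  · obtain ⟨K, hK⟩ := eventually_atTop.1 (hs.finite_termination hM hκ hKLz)
    refine ⟨K + 1, fun k hk => ?_⟩
    obtain ⟨j, rfl⟩ := Nat.exists_eq_add_of_le' hk
    have h1 := congrArg WithLp.ofLp (hK (j + K) (by omega))
    exact Prod.mk.inj h1
  -- The rates bound `x (k + 2)` in terms of `k`: one shift comes from leaving out the starting
  -- point, the other from the rates for descent sequences.
  · obtain ⟨A, ζ, hA, hζ, hζ1, hr⟩ := hs.linear_rate hM hκ hκ2 hKLz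
    obtain ⟨A', hA', hb⟩ := exists_forall_le_of_eventually (e := fun k => ‖x k - xlim‖)
      (v := fun k => ζ ^ k) (B := (ζ ^ 2)⁻¹) (k₀ := 0) (m := 2) (fun k _ => by positivity) hA
      (fun k _ => by
        rw [pow_add]
        field_simp
        rfl)
      (hr.mono fun k hk => (hdist (k + 1)).trans hk)
    exact ⟨A', hA', ζ, hζ, hζ1, fun k => hb k (Nat.zero_le k)⟩
  · obtain ⟨A, hA, hr⟩ := hs.sublinear_rate hM hκ hκ1 hKLz
    have he : (1 - κ) / (1 - 2 * κ) ≤ 0 :=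
      div_nonpos_of_nonneg_of_nonpos (by linarith) (by linarith)
    obtain ⟨A', hA', hb⟩ := exists_forall_le_of_eventually (e := fun k => ‖x k - xlim‖)
      (v := fun k => (k : ℝ) ^ ((1 - κ) / (1 - 2 * κ)))
      (B := ((3 : ℝ) ^ ((1 - κ) / (1 - 2 * κ)))⁻¹) (k₀ := 1) (m := 2)
      (fun k hk => by
        have : (0 : ℝ) < k := by exact_mod_cast hk
        positivity) hA
      (fun k hk => by
        have hk1 : (1 : ℝ) ≤ k := by exact_mod_cast hk
        rw [← div_eq_inv_mul, le_div_iff₀ (by positivity), ← Real.mul_rpow (by positivity)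
          (by positivity)]
        refine Real.rpow_le_rpow_of_nonpos (by positivity) ?_ he
        push_cast
        linarith)
      (hr.mono fun k hk => (hdist (k + 1)).trans hk)
    exact ⟨A', hA', hb⟩
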